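/- All vector spaces are complex and finite-dimensional. Let $\mathfrak g=\mathfrak g_{\bar 0}\oplus\mathfrak g_{\bar 1}$ be a $\mathbb Z_2$-graded vector space with a non-degenerate even supersymmetric bilinear form $B$, i.e. $B(\mathfrak g_{\bar0},\mathfrak g_{\bar1})=0$ and $B(X,Y)=(-1)^{xy}B(Y,X)$ for $X\in\mathfrak g_x$, $Y\in\mathfrak g_y$. Notation. Let $\mathrm{Alt}(\mathfrak g_{\bar0})$ be the exterior algebra of $\mathfrak g_{\bar0}^*$ and $\mathrm{Sym}(\mathfrak g_{\bar1})$ the symmetric algebra of $\mathfrak g_{\bar1}^*$. The super-exterior algebra is $\mathscr E(\mathfrak g)=\mathrm{Alt}(\mathfrak g_{\bar0})\otimes\mathrm{Sym}(\mathfrak g_{\bar1})$ with product $$(\Omega\otimes F)\wedge(\Omega'\otimes F')=(-1)^{f\omega'}(\Omega\wedge\Omega')\otimes FF'\qquad(F\in\mathrm{Sym}^f,\ \Omega'\in\mathrm{Alt}^{\omega'});$$ $\mathscr E^{(n,b)}(\mathfrak g)$ is the sum of the $\mathrm{Alt}^{\omega}\otimes\mathrm{Sym}^{f}$ with $\omega+f=n$,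 $f\equiv b$ mod $2$, and $\mathscr E^n(\mathfrak g)=\mathscr E^{(n,\bar0)}(\mathfrak g)\oplus\mathscr E^{(n,\bar1)}(\mathfrak g)$. For $X\in\mathfrak g_x$ let $\iota_X$ be the super-derivation of $\mathscr E(\mathfrak g)$ of degree $(-1,x)$, i.e. $\iota_X(A\wedge A')=\iota_X(A)\wedge A'+(-1)^{a+xb}A\wedge\iota_X(A')$ for $A\in\mathscr E^{(a,b)}(\mathfrak g)$, with $\iota_X(\alpha)=(-1)^{xy}\alpha(X)$ for $\alpha\in\mathfrak g_y^*$. Elements of $\mathscr E^n(\mathfrak g)$ are identified with super-antisymmetric $n$-linear forms on $\mathfrak g$ by $A(X,X_2,\dots,X_n)=(-1)^{xb}\,\iota_X(A)(X_2,\dots,X_n)$ for $A\in\mathscr E^{(n,b)}(\mathfrak g)$, $X\in\mathfrak g_x$. Let $\{Z_j\}$ be an orthonormal basis of $\mathfrak g_{\bar0}$ and $\{X_i,Y_i\}$ a Darboux basis of $\mathfrak g_{\bar1}$ ($B(X_i,X_j)=B(Y_i,Y_j)=0$, $B(X_i,Y_j)=\delta_{ij}$) with dual basis $\{p_i,q_i\}$;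 such bases exist, and the statements below hold for any choice of them. Put $\{\Omega,\Omega'\}=(-1)^{\omega+1}\sum_j\iota_{Z_j}(\Omega)\wedge\iota_{Z_j}(\Omega')$ for $\Omega\in\mathrm{Alt}^\omega(\mathfrak g_{\bar0})$, $\{F,F'\}=\sum_i\left(\frac{\partial F}{\partial p_i}\frac{\partial F'}{\partial q_i}-\frac{\partial F}{\partial q_i}\frac{\partial F'}{\partial p_i}\right)$ on $\mathrm{Sym}(\mathfrak g_{\bar1})$, and define on $\mathscr E(\mathfrak g)$ the super $\mathbb Z\times\mathbb Z_2$-Poisson bracket $$\{\Omega\otimes F,\Omega'\otimes F'\}=(-1)^{f\omega'}\big(\{\Omega,\Omega'\}\otimes FF'+(\Omega\wedge\Omega')\otimes\{F,F'\}\big),\qquad \mathrm{ad}_P(A)=\{A,\cdot\}.$$ For $t=\sum_i\Omega_i\otimes X_i\in\mathscr E^2(\mathfrak g)\otimes\mathfrak g$ with $\Omega_i$ of parity $\omega_i$ and $X_i\in\mathfrak g_{x_i}$, representing the bilinear map $F(Y,Z)=\sum_i\Omega_i(Y,Z)X_i$, put $D_F=-\sum_i(-1)^{x_i\omega_i}\,\Omega_i\wedge\iota_{X_i}\in\mathrm{End}(\mathscr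 E(\mathfrak g))$. If $F$ is a Lie superalgebra bracket, $d=D_F$ is called the super-exterior differential of $(\mathfrak g,F)$. (A) Let $[\cdot,\cdot]$ be a Lie superalgebra structure on $\mathfrak g$ for which $B$ is invariant: $B([X,Y],Z)=B(X,[Y,Z])$ for all $X,Y,Z$. Then the trilinear form $I(X,Y,Z)=B([X,Y],Z)$ belongs to $\mathscr E^{(3,\bar0)}(\mathfrak g)=\mathrm{Alt}^3(\mathfrak g_{\bar0})\oplus\big(\mathrm{Alt}^1(\mathfrak g_{\bar0})\otimes\mathrm{Sym}^2(\mathfrak g_{\bar1})\big)$ (i.e. it is the form of an element of this space, unique in $\mathscr E^3(\mathfrak g)$); the super-exterior differential of $(\mathfrak g,[\cdot,\cdot])$ is $d=-\mathrm{ad}_P(I)$; and $\{I,I\}=0$. (B) Let $I\in\mathscr E^{(3,\bar0)}(\mathfrak g)$. There is exactly one bilinear map $F:\mathfrak g\times\mathfrak g\to\mathfrak g$ with $D_F=-\mathrm{ad}_P(I)$, and it is even and super-antisymmetric. $F$ is a Lie superalgebra structure if and only if $\{I,I\}=0$. In this case, writing $[X,Y]=F(X,Y)$, one has $I(X,Y,Z)=B([X,Y],Z)$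 for all $X,Y,Z\in\mathfrak g$, and $B$ is invariant. (C) Consequently, mapping a structure to its form $I$ is a bijection from the set of Lie superalgebra structures on $\mathfrak g$ for which $B$ is invariant onto the set of $I\in\mathscr E^{(3,\bar0)}(\mathfrak g)$ with $\{I,I\}=0$, and under it the super-exterior differential of a structure is $-\mathrm{ad}_P(I)$. -/

import Mathlib

open scoped TensorProduct DirectSum

noncomputable section

namespace QuadSuper

/-! A `ℤ/2`-graded vector space `g = g₀ ⊕ g₁` is given by its even part `V₀` and its odd part `V₁`;
the total space is `V₀ × V₁`. -/

section Algebras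

variable (V₀ V₁ : Type*) [AddCommGroup V₀] [Module ℂ V₀] [AddCommGroup V₁] [Module ℂ V₁]

/-- `Alt(g₀)`, the exterior algebra of `g₀*`. -/
abbrev Alt : Type _ := ExteriorAlgebra ℂ (Module.Dual ℂ V₀)

/-- `Sym(g₁)`, the symmetric algebra of `g₁*`. -/
abbrev Sym : Type _ := SymmetricAlgebra ℂ (Module.Dual ℂ V₁)

/-- `Alt^i(g₀)`. -/
abbrev altPow (i : ℕ) : Submodule ℂ (Alt V₀) := ⋀[ℂ]^i (Module.Dual ℂ V₀)

/-- `Sym^i(g₁)`, spanned by the products of `i` linear forms. -/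
def symPow (i : ℕ) : Submodule ℂ (Sym V₁) :=
  LinearMap.range (SymmetricAlgebra.ι ℂ (Module.Dual ℂ V₁)) ^ i

instance : SetLike.GradedMonoid (symPow V₁) :=
  Submodule.nat_power_gradedMonoid (LinearMap.range (SymmetricAlgebra.ι ℂ (Module.Dual ℂ V₁)))

theorem ι_mem_symPow (p : Module.Dual ℂ V₁) :
    SymmetricAlgebra.ι ℂ (Module.Dual ℂ V₁) p ∈ symPow V₁ 1 := by
  simpa only [symPow, pow_one] using LinearMap.mem_range_self _ p

/-- Auxiliary map: `Sym(g₁) → ⨁ i, Sym^i(g₁)`. -/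
def symToGraded : Sym V₁ →ₐ[ℂ] ⨁ i : ℕ, symPow V₁ i :=
  SymmetricAlgebra.lift
    (DirectSum.lof ℂ ℕ (fun i => symPow V₁ i) 1 ∘ₗ
      (SymmetricAlgebra.ι ℂ (Module.Dual ℂ V₁)).codRestrict _ (ι_mem_symPow V₁))

theorem symToGraded_eq (i : ℕ) (x : symPow V₁ i) :
    symToGraded V₁ x = DirectSum.of (fun i => symPow V₁ i) i x := by
  obtain ⟨x, hx⟩ := x
  dsimp only [Subtype.coe_mk]
  unfold symPow at hx
  induction hx using Submodule.pow_induction_on_left' with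
  | algebraMap => simp_rw [AlgHom.commutes, DirectSum.algebraMap_apply]; rfl
  | add _ _ _ _ _ ihx ihy => simp_rw [map_add, ihx, ihy, ← map_add]; rfl
  | mem_mul _ hm _ _ _ ih =>
      obtain ⟨p, rfl⟩ := hm
      have h1 : symToGraded V₁ (SymmetricAlgebra.ι ℂ (Module.Dual ℂ V₁) p) =
          DirectSum.of (fun i => symPow V₁ i) 1 ⟨_, ι_mem_symPow V₁ p⟩ := by
        rw [symToGraded, SymmetricAlgebra.lift_ι_apply]; rfl
      rw [map_mul, ih, h1, DirectSum.of_mul_of]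
      exact DirectSum.of_eq_of_gradedMonoid_eq (Sigma.subtype_ext (add_comm _ _) rfl)

instance symGraded : GradedAlgebra (symPow V₁) :=
  GradedAlgebra.ofAlgHom _ (symToGraded V₁)
    (by
      ext p
      change DirectSum.coeAlgHom (symPow V₁)
        (symToGraded V₁ (SymmetricAlgebra.ι ℂ (Module.Dual ℂ V₁) p)) = _
      rw [symToGraded, SymmetricAlgebra.lift_ι_apply, LinearMap.comp_apply, DirectSum.lof_eq_of,
        DirectSum.coeAlgHom_of]
      rfl)
    (symToGraded_eq V₁)

/-- The super-exterior algebra `E(g) = Alt(g₀) ⊗ Sym(g₁)`. Its multiplication `*` is the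
super-exterior product
`(Ω ⊗ F) ∧ (Ω' ⊗ F') = (-1)^{f ω'} (Ω ∧ Ω') ⊗ F F'` for `F ∈ Sym^f`, `Ω' ∈ Alt^{ω'}`. -/
abbrev SuperExt : Type _ := GradedTensorProduct ℂ (fun i : ℕ => altPow V₀ i) (symPow V₁)

/-- The identification of the super-exterior algebra, as a vector space, with the tensor product. -/
def ofTensor : Alt V₀ ⊗[ℂ] Sym V₁ ≃ₗ[ℂ] SuperExt V₀ V₁ :=
  GradedTensorProduct.of ℂ (fun i : ℕ => altPow V₀ i) (symPow V₁)

/-- `Alt^ω(g₀) ⊗ Sym^f(g₁)` inside `E(g)`. -/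
def tensorPart (ω f : ℕ) : Submodule ℂ (SuperExt V₀ V₁) :=
  Submodule.span ℂ {A | ∃ Ω ∈ altPow V₀ ω, ∃ F ∈ symPow V₁ f, A = ofTensor V₀ V₁ (Ω ⊗ₜ[ℂ] F)}

/-- `E^{(n,b)}(g)`, the sum of the `Alt^ω ⊗ Sym^f` with `ω + f = n` and `f ≡ b mod 2`. -/
def bidegree (n : ℕ) (b : ZMod 2) : Submodule ℂ (SuperExt V₀ V₁) :=
  ⨆ (ω : ℕ) (f : ℕ) (_ : ω + f = n ∧ (f : ZMod 2) = b), tensorPart V₀ V₁ ω f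

/-- `E^n(g)`, the sum of the `Alt^ω ⊗ Sym^f` with `ω + f = n`. -/
def degree (n : ℕ) : Submodule ℂ (SuperExt V₀ V₁) :=
  ⨆ (ω : ℕ) (f : ℕ) (_ : ω + f = n), tensorPart V₀ V₁ ω f

/-- The linear map of `E(g)` with `Ω ⊗ F ↦ u Ω ⊗ v F`. -/
def mapTensor (u : Alt V₀ →ₗ[ℂ] Alt V₀) (v : Sym V₁ →ₗ[ℂ] Sym V₁) :
    SuperExt V₀ V₁ →ₗ[ℂ] SuperExt V₀ V₁ :=
  (ofTensor V₀ V₁).toLinearMap ∘ₗ TensorProduct.map u v ∘ₗ (ofTensor V₀ V₁).symm.toLinearMap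

/-- `Ω ↦ (-1)^ω Ω` for `Ω ∈ Alt^ω(g₀)`. -/
def altSign : Alt V₀ →ₗ[ℂ] Alt V₀ :=
  (CliffordAlgebra.involute : Alt V₀ →ₐ[ℂ] Alt V₀).toLinearMap

/-- `F ↦ (-1)^f F` for `F ∈ Sym^f(g₁)`. -/
def symSign : Sym V₁ →ₗ[ℂ] Sym V₁ :=
  (SymmetricAlgebra.lift (-(SymmetricAlgebra.ι ℂ (Module.Dual ℂ V₁))) :
    Sym V₁ →ₐ[ℂ] Sym V₁).toLinearMap

/-- `A ↦ (-1)^b A` for `A ∈ E^{(a,b)}(g)`. -/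
def paritySign : SuperExt V₀ V₁ →ₗ[ℂ] SuperExt V₀ V₁ :=
  mapTensor V₀ V₁ LinearMap.id (symSign V₁)

/-- The braiding `F ⊗ Ω ↦ (-1)^{f ω} Ω ⊗ F` for `F ∈ Sym^f(g₁)`, `Ω ∈ Alt^ω(g₀)`. -/
def braid : Sym V₁ ⊗[ℂ] Alt V₀ →ₗ[ℂ] Alt V₀ ⊗[ℂ] Sym V₁ :=
  (TensorProduct.congr (DirectSum.decomposeLinearEquiv (fun i : ℕ => altPow V₀ i))
      (DirectSum.decomposeLinearEquiv (symPow V₁))).symm.toLinearMap ∘ₗ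
    (TensorProduct.gradedComm ℂ (fun i => symPow V₁ i) (fun i : ℕ => altPow V₀ i)).toLinearMap ∘ₗ
    (TensorProduct.congr (DirectSum.decomposeLinearEquiv (symPow V₁))
      (DirectSum.decomposeLinearEquiv (fun i : ℕ => altPow V₀ i))).toLinearMap

theorem braid_tmul {f ω : ℕ} {F : Sym V₁} (hF : F ∈ symPow V₁ f) {Ω : Alt V₀}
    (hΩ : Ω ∈ altPow V₀ ω) :
    braid V₀ V₁ (F ⊗ₜ[ℂ] Ω) = (-1 : ℂ) ^ (f * ω) • (Ω ⊗ₜ[ℂ] F) := by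
  lift F to symPow V₁ f using hF
  lift Ω to altPow V₀ ω using hΩ
  simp only [braid, LinearMap.comp_apply, LinearEquiv.coe_coe, TensorProduct.congr_tmul,
    DirectSum.decomposeLinearEquiv_apply, DirectSum.decompose_coe]
  rw [← DirectSum.lof_eq_of ℂ, ← DirectSum.lof_eq_of ℂ, TensorProduct.gradedComm_of_tmul_of,
    Units.smul_def, ← Int.cast_smul_eq_zsmul ℂ, LinearEquiv.map_smul,
    TensorProduct.congr_symm_tmul]
  congr 1
  · rw [mul_comm]; push_cast [uzpow_natCast]; simp
  · rw [DirectSum.lof_eq_of, DirectSum.lof_eq_of]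
    congr 1 <;> exact DirectSum.decompose_symm_of _ _

/-- For bilinear operations `m` on `Alt(g₀)` and `m'` on `Sym(g₁)`, the bilinear operation
`(Ω ⊗ F, Ω' ⊗ F') ↦ (-1)^{f ω'} m(Ω, Ω') ⊗ m'(F, F')` on `E(g)`. -/
def twisted (m : Alt V₀ →ₗ[ℂ] Alt V₀ →ₗ[ℂ] Alt V₀) (m' : Sym V₁ →ₗ[ℂ] Sym V₁ →ₗ[ℂ] Sym V₁) :
    SuperExt V₀ V₁ →ₗ[ℂ] SuperExt V₀ V₁ →ₗ[ℂ] SuperExt V₀ V₁ :=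
  ((TensorProduct.curry
    (TensorProduct.map (TensorProduct.lift m) (TensorProduct.lift m') ∘ₗ
      (TensorProduct.assoc ℂ (Alt V₀) (Alt V₀) (Sym V₁ ⊗[ℂ] Sym V₁)).symm.toLinearMap ∘ₗ
      LinearMap.lTensor (Alt V₀)
        ((TensorProduct.assoc ℂ (Alt V₀) (Sym V₁) (Sym V₁)).toLinearMap ∘ₗ
          LinearMap.rTensor (Sym V₁) (braid V₀ V₁) ∘ₗ
          (TensorProduct.assoc ℂ (Sym V₁) (Alt V₀) (Sym V₁)).symm.toLinearMap) ∘ₗ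
      (TensorProduct.assoc ℂ (Alt V₀) (Sym V₁) (Alt V₀ ⊗[ℂ] Sym V₁)).toLinearMap)).compl₁₂
    (ofTensor V₀ V₁).symm.toLinearMap (ofTensor V₀ V₁).symm.toLinearMap).compr₂
    (ofTensor V₀ V₁).toLinearMap

theorem twisted_tmul (m : Alt V₀ →ₗ[ℂ] Alt V₀ →ₗ[ℂ] Alt V₀)
    (m' : Sym V₁ →ₗ[ℂ] Sym V₁ →ₗ[ℂ] Sym V₁) {f ω' : ℕ} (Ω : Alt V₀) {F : Sym V₁}
    (hF : F ∈ symPow V₁ f) {Ω' : Alt V₀} (hΩ' : Ω' ∈ altPow V₀ ω') (F' : Sym V₁) :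
    twisted V₀ V₁ m m' (ofTensor V₀ V₁ (Ω ⊗ₜ[ℂ] F)) (ofTensor V₀ V₁ (Ω' ⊗ₜ[ℂ] F')) =
      (-1 : ℂ) ^ (f * ω') • ofTensor V₀ V₁ (m Ω Ω' ⊗ₜ[ℂ] m' F F') := by
  simp only [twisted, LinearMap.compr₂_apply, LinearMap.compl₁₂_apply, LinearEquiv.coe_coe,
    LinearEquiv.symm_apply_apply, TensorProduct.curry_apply, LinearMap.comp_apply,
    TensorProduct.assoc_tmul, LinearMap.lTensor_tmul, TensorProduct.assoc_symm_tmul,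
    LinearMap.rTensor_tmul, braid_tmul V₀ V₁ hF hΩ', ← TensorProduct.smul_tmul', map_smul,
    TensorProduct.tmul_smul, TensorProduct.map_tmul, TensorProduct.lift.tmul]

end Algebras

section Interior

variable {V₀ V₁ : Type*} [AddCommGroup V₀] [Module ℂ V₀] [AddCommGroup V₁] [Module ℂ V₁]

/-- The interior product `ι_X` on `Alt(g₀)`: the super-derivation of degree `-1` with
`ι_X(α) = α(X)` for `α ∈ g₀*`. -/
def altInterior (X : V₀) : Alt V₀ →ₗ[ℂ] Alt V₀ :=
  CliffordAlgebra.contractLeft (Module.Dual.eval ℂ V₀ X)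

/-- Auxiliary map `F ↦ F + ε ∂_X F`. -/
def symDerivAux (X : V₁) : Sym V₁ →ₐ[ℂ] TrivSqZeroExt (Sym V₁) (Sym V₁) :=
  SymmetricAlgebra.lift
    ((TrivSqZeroExt.inlAlgHom ℂ (Sym V₁) (Sym V₁)).toLinearMap ∘ₗ
        SymmetricAlgebra.ι ℂ (Module.Dual ℂ V₁) +
      (TrivSqZeroExt.inrHom (Sym V₁) (Sym V₁)).restrictScalars ℂ ∘ₗ
        Algebra.linearMap ℂ (Sym V₁) ∘ₗ Module.Dual.eval ℂ V₁ X)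

theorem fst_symDerivAux (X : V₁) (F : Sym V₁) : (symDerivAux X F).fst = F := by
  have h : (TrivSqZeroExt.fstHom ℂ (Sym V₁) (Sym V₁)).comp (symDerivAux X) =
      AlgHom.id ℂ (Sym V₁) := by
    ext p
    simp [symDerivAux]
  exact congrArg (fun φ : Sym V₁ →ₐ[ℂ] Sym V₁ => φ F) h

/-- The partial derivative `∂_X` on the polynomial algebra `Sym(g₁)`: the derivation with
`∂_X p = p(X)` for `p ∈ g₁*`. -/
def symDeriv (X : V₁) : Derivation ℂ (Sym V₁) (Sym V₁) :=
  Derivation.mk'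
    ((TrivSqZeroExt.sndHom (Sym V₁) (Sym V₁)).restrictScalars ℂ ∘ₗ (symDerivAux X).toLinearMap)
    (fun F G => by
      simp [fst_symDerivAux, mul_comm])

theorem symDeriv_ι (X : V₁) (p : Module.Dual ℂ V₁) :
    symDeriv X (SymmetricAlgebra.ι ℂ _ p) = algebraMap ℂ (Sym V₁) (p X) := by
  simp [symDeriv, symDerivAux, Algebra.algebraMap_eq_smul_one]

theorem symDeriv_add_smul (c : ℂ) (X Y : V₁) (F : Sym V₁) :
    symDeriv (c • X + Y) F = c • symDeriv X F + symDeriv Y F := by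
  induction F using SymmetricAlgebra.induction with
  | algebraMap r => simp
  | ι p => simp [symDeriv_ι, Algebra.smul_def]
  | mul F G hF hG => simp only [Derivation.leibniz, hF, hG, smul_eq_mul, mul_add,
      mul_smul_comm, smul_add]; abel
  | add F G hF hG => simp only [map_add, hF, hG, smul_add]; abel

variable (V₀ V₁) in
/-- The component in `E^0(g) = ℂ`. -/
def scalarPart : SuperExt V₀ V₁ →ₗ[ℂ] ℂ :=
  TensorProduct.lift ((LinearMap.mul ℂ ℂ).compl₁₂
    (ExteriorAlgebra.algebraMapInv (R := ℂ) (M := Module.Dual ℂ V₀)).toLinearMap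
    (SymmetricAlgebra.algebraMapInv (R := ℂ) (M := Module.Dual ℂ V₁)).toLinearMap) ∘ₗ
    (ofTensor V₀ V₁).symm.toLinearMap

/-- The interior product `ι_X` on `E(g)` by an even `X`: `ι_X(Ω ⊗ F) = ι_X(Ω) ⊗ F`. -/
def evenInterior (X : V₀) : SuperExt V₀ V₁ →ₗ[ℂ] SuperExt V₀ V₁ :=
  mapTensor V₀ V₁ (altInterior X) LinearMap.id

/-- The interior product `ι_X` on `E(g)` by an odd `X`: `ι_X(Ω ⊗ F) = (-1)^ω Ω ⊗ ι_X(F)`, where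
`ι_X(F) = -∂_X F`. It is the super-derivation of degree `(-1, 1)` with `ι_X(α) = 0` for `α ∈ g₀*`
and `ι_X(p) = -p(X)` for `p ∈ g₁*`. -/
def oddInterior (X : V₁) : SuperExt V₀ V₁ →ₗ[ℂ] SuperExt V₀ V₁ :=
  mapTensor V₀ V₁ (altSign V₀) (-(symDeriv X).toLinearMap)

theorem mapTensor_add_smul_left (c : ℂ) (u u' : Alt V₀ →ₗ[ℂ] Alt V₀)
    (v : Sym V₁ →ₗ[ℂ] Sym V₁) (A : SuperExt V₀ V₁) :
    mapTensor V₀ V₁ (c • u + u') v A = c • mapTensor V₀ V₁ u v A + mapTensor V₀ V₁ u' v A := by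
  simp [mapTensor, TensorProduct.map_add_left, TensorProduct.map_smul_left]

theorem mapTensor_add_smul_right (c : ℂ) (u : Alt V₀ →ₗ[ℂ] Alt V₀)
    (v v' : Sym V₁ →ₗ[ℂ] Sym V₁) (A : SuperExt V₀ V₁) :
    mapTensor V₀ V₁ u (c • v + v') A = c • mapTensor V₀ V₁ u v A + mapTensor V₀ V₁ u v' A := by
  simp [mapTensor, TensorProduct.map_add_right, TensorProduct.map_smul_right]

theorem evenInterior_add_smul (c : ℂ) (X Y : V₀) (A : SuperExt V₀ V₁) :
    evenInterior (c • X + Y) A = c • evenInterior X A + evenInterior Y A := by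
  rw [evenInterior, evenInterior, evenInterior, ← mapTensor_add_smul_left]
  simp [altInterior]

theorem oddInterior_add_smul (c : ℂ) (X Y : V₁) (A : SuperExt V₀ V₁) :
    oddInterior (c • X + Y) A = c • oddInterior X A + oddInterior Y A := by
  rw [oddInterior, oddInterior, oddInterior, ← mapTensor_add_smul_right]
  congr 2
  refine LinearMap.ext fun F => ?_
  change -(symDeriv (c • X + Y) F) = c • -(symDeriv X F) + -(symDeriv Y F)
  rw [symDeriv_add_smul, smul_neg, neg_add]

theorem evenInterior_add (X Y : V₀) (A : SuperExt V₀ V₁) :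
    evenInterior (X + Y) A = evenInterior X A + evenInterior Y A := by
  simpa using evenInterior_add_smul 1 X Y A

theorem oddInterior_add (X Y : V₁) (A : SuperExt V₀ V₁) :
    oddInterior (X + Y) A = oddInterior X A + oddInterior Y A := by
  simpa using oddInterior_add_smul 1 X Y A

theorem evenInterior_smul (c : ℂ) (X : V₀) (A : SuperExt V₀ V₁) :
    evenInterior (c • X) A = c • evenInterior X A := by
  have h0 : evenInterior (0 : V₀) A = 0 := by simpa using evenInterior_add_smul 1 (0 : V₀) 0 A
  simpa [h0] using evenInterior_add_smul c X 0 A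

theorem oddInterior_smul (c : ℂ) (X : V₁) (A : SuperExt V₀ V₁) :
    oddInterior (c • X) A = c • oddInterior X A := by
  have h0 : oddInterior (0 : V₁) A = 0 := by simpa using oddInterior_add_smul 1 (0 : V₁) 0 A
  simpa [h0] using oddInterior_add_smul c X 0 A

/-- An element of `E(g)` as a super-antisymmetric multilinear form on `g`: `eval n v A` is the value
`A(v₀, …, vₙ₋₁)` of (the component in `E^n(g)` of) `A`. The interior product of a form `A` of parity
`b` by `X` of parity `x` is `ι_X(A)(X₂, …) = (-1)^{x b} A(X, X₂, …)`; this relation, extended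
linearly to all `X` and `A`, determines the values. -/
def eval : (n : ℕ) → (Fin n → V₀ × V₁) → SuperExt V₀ V₁ →ₗ[ℂ] ℂ
  | 0, _ => scalarPart V₀ V₁
  | n + 1, v =>
      eval n (Fin.tail v) ∘ₗ
        (evenInterior (v 0).1 + oddInterior (v 0).2 ∘ₗ paritySign V₀ V₁)

end Interior

section Forms

variable {V₀ V₁ : Type*} [AddCommGroup V₀] [Module ℂ V₀] [AddCommGroup V₁] [Module ℂ V₁]

variable (V₀ V₁) in
/-- The homogeneous parts `g₀` and `g₁` of `g`. -/
def part (x : ZMod 2) : Submodule ℂ (V₀ × V₁) :=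
  if x = 0 then LinearMap.range (LinearMap.inl ℂ V₀ V₁) else LinearMap.range (LinearMap.inr ℂ V₀ V₁)

/-- The sign `(-1)^{xy}`. -/
def sgn (x y : ZMod 2) : ℂ := (-1) ^ (x.val * y.val)

/-- A quadratic `ℤ/2`-graded vector space: `B` is even, supersymmetric and non-degenerate. -/
structure IsQuadraticSpace (B : LinearMap.BilinForm ℂ (V₀ × V₁)) : Prop where
  even : ∀ X ∈ part V₀ V₁ 0, ∀ Y ∈ part V₀ V₁ 1, B X Y = 0
  supersymm : ∀ x y : ZMod 2, ∀ X ∈ part V₀ V₁ x, ∀ Y ∈ part V₀ V₁ y, B X Y = sgn x y * B Y X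
  nondegenerate : B.Nondegenerate

/-- An even super-antisymmetric bilinear map `g × g → g`. -/
structure IsEvenSuperAntisymm (F : V₀ × V₁ →ₗ[ℂ] V₀ × V₁ →ₗ[ℂ] V₀ × V₁) : Prop where
  even : ∀ x y : ZMod 2, ∀ X ∈ part V₀ V₁ x, ∀ Y ∈ part V₀ V₁ y, F X Y ∈ part V₀ V₁ (x + y)
  antisymm : ∀ x y : ZMod 2, ∀ X ∈ part V₀ V₁ x, ∀ Y ∈ part V₀ V₁ y, F X Y = -sgn x y • F Y X

/-- `[X, Y] = F(X, Y)` is a Lie superalgebra structure on `g`. -/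
structure IsLieSuper (F : V₀ × V₁ →ₗ[ℂ] V₀ × V₁ →ₗ[ℂ] V₀ × V₁) : Prop
    extends IsEvenSuperAntisymm F where
  jacobi : ∀ x y : ZMod 2, ∀ X ∈ part V₀ V₁ x, ∀ Y ∈ part V₀ V₁ y, ∀ Z,
    F X (F Y Z) = F (F X Y) Z + sgn x y • F Y (F X Z)

/-- `B` is invariant: `B([X, Y], Z) = B(X, [Y, Z])`. -/
def IsInvariant (B : LinearMap.BilinForm ℂ (V₀ × V₁))
    (F : V₀ × V₁ →ₗ[ℂ] V₀ × V₁ →ₗ[ℂ] V₀ × V₁) : Prop :=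
  ∀ X Y Z, B (F X Y) Z = B X (F Y Z)

/-- A quadratic Lie superalgebra structure on `(g, B)`. -/
def IsQuadraticLieSuper (B : LinearMap.BilinForm ℂ (V₀ × V₁))
    (F : V₀ × V₁ →ₗ[ℂ] V₀ × V₁ →ₗ[ℂ] V₀ × V₁) : Prop :=
  IsLieSuper F ∧ IsInvariant B F

/-- `I(X, Y, Z) = B([X, Y], Z)` for all `X, Y, Z`. -/
def IsAssociated (B : LinearMap.BilinForm ℂ (V₀ × V₁))
    (F : V₀ × V₁ →ₗ[ℂ] V₀ × V₁ →ₗ[ℂ] V₀ × V₁) (I : SuperExt V₀ V₁) : Prop :=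
  ∀ X Y Z, eval 3 ![X, Y, Z] I = B (F X Y) Z

/-- An orthonormal basis `Z₁, …, Zₘ` of `g₀` together with a Darboux basis
`X₁, …, Xₙ, Y₁, …, Yₙ` of `g₁`. -/
structure AdaptedBasis (B : LinearMap.BilinForm ℂ (V₀ × V₁)) where
  m : ℕ
  n : ℕ
  even : Module.Basis (Fin m) ℂ V₀
  odd : Module.Basis (Fin n ⊕ Fin n) ℂ V₁
  orthonormal : ∀ i j, B (even i, 0) (even j, 0) = if i = j then 1 else 0
  darboux_inl : ∀ i j, B (0, odd (.inl i)) (0, odd (.inl j)) = 0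
  darboux_inr : ∀ i j, B (0, odd (.inr i)) (0, odd (.inr j)) = 0
  darboux : ∀ i j, B (0, odd (.inl i)) (0, odd (.inr j)) = if i = j then 1 else 0

variable {B : LinearMap.BilinForm ℂ (V₀ × V₁)}

/-- The super Poisson bracket of `Alt(g₀)`:
`{Ω, Ω'} = (-1)^{k+1} ∑ⱼ ι_{Zⱼ}(Ω) ∧ ι_{Zⱼ}(Ω')` for `Ω ∈ Alt^k(g₀)`. -/
def altPoisson (b : AdaptedBasis B) : Alt V₀ →ₗ[ℂ] Alt V₀ →ₗ[ℂ] Alt V₀ :=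
  -∑ j, (LinearMap.mul ℂ (Alt V₀)).compl₁₂ (altInterior (b.even j) ∘ₗ altSign V₀)
    (altInterior (b.even j))

/-- The Poisson bracket of `Sym(g₁)`:
`{F, G} = ∑ᵢ (∂F/∂pᵢ ∂G/∂qᵢ - ∂F/∂qᵢ ∂G/∂pᵢ)`, where `p₁, …, pₙ, q₁, …, qₙ` is the dual basis of
the Darboux basis `X₁, …, Xₙ, Y₁, …, Yₙ`, so that `∂/∂pᵢ = ∂_{Xᵢ}` and `∂/∂qᵢ = ∂_{Yᵢ}`. -/
def symPoisson (b : AdaptedBasis B) : Sym V₁ →ₗ[ℂ] Sym V₁ →ₗ[ℂ] Sym V₁ :=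
  ∑ i, ((LinearMap.mul ℂ (Sym V₁)).compl₁₂ (symDeriv (b.odd (.inl i))).toLinearMap
        (symDeriv (b.odd (.inr i))).toLinearMap -
      (LinearMap.mul ℂ (Sym V₁)).compl₁₂ (symDeriv (b.odd (.inr i))).toLinearMap
        (symDeriv (b.odd (.inl i))).toLinearMap)

/-- The super `ℤ × ℤ/2`-Poisson bracket of `E(g)`:
`{Ω ⊗ F, Ω' ⊗ F'} = (-1)^{f ω'} ({Ω, Ω'} ⊗ F F' + (Ω ∧ Ω') ⊗ {F, F'})`.
The map `poisson b A` is `ad_P(A)`. -/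
def poisson (b : AdaptedBasis B) :
    SuperExt V₀ V₁ →ₗ[ℂ] SuperExt V₀ V₁ →ₗ[ℂ] SuperExt V₀ V₁ :=
  twisted V₀ V₁ (altPoisson b) (LinearMap.mul ℂ (Sym V₁)) +
    twisted V₀ V₁ (LinearMap.mul ℂ (Alt V₀)) (symPoisson b)

theorem poisson_tmul (b : AdaptedBasis B) {f ω' : ℕ} (Ω : Alt V₀) {F : Sym V₁}
    (hF : F ∈ symPow V₁ f) {Ω' : Alt V₀} (hΩ' : Ω' ∈ altPow V₀ ω') (F' : Sym V₁) :
    poisson b (ofTensor V₀ V₁ (Ω ⊗ₜ[ℂ] F)) (ofTensor V₀ V₁ (Ω' ⊗ₜ[ℂ] F')) =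
      (-1 : ℂ) ^ (f * ω') • ofTensor V₀ V₁
        (altPoisson b Ω Ω' ⊗ₜ[ℂ] (F * F') + (Ω * Ω') ⊗ₜ[ℂ] symPoisson b F F') := by
  simp [poisson, twisted_tmul V₀ V₁ _ _ Ω hF hΩ' F']

end Forms

section Differential

variable {V₀ V₁ : Type*} [AddCommGroup V₀] [Module ℂ V₀] [AddCommGroup V₁] [Module ℂ V₁]

/-- The linear map `E(g) ⊗ g → End(E(g))` with `Ω ⊗ X ↦ -(-1)^{x ω} Ω ∧ ι_X` for `X ∈ g_x` and
`Ω ∈ E(g)` of parity `ω`. -/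
def superD : SuperExt V₀ V₁ ⊗[ℂ] (V₀ × V₁) →ₗ[ℂ] (SuperExt V₀ V₁ →ₗ[ℂ] SuperExt V₀ V₁) :=
  TensorProduct.lift (LinearMap.mk₂ ℂ
    (fun Ω X => -(LinearMap.mulLeft ℂ Ω ∘ₗ evenInterior X.1 +
      LinearMap.mulLeft ℂ (paritySign V₀ V₁ Ω) ∘ₗ oddInterior X.2))
    (fun Ω Ω' X => by
      refine LinearMap.ext fun A => ?_
      simp only [LinearMap.neg_apply, LinearMap.add_apply, LinearMap.comp_apply,
        LinearMap.mulLeft_apply, map_add, add_mul]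
      abel)
    (fun c Ω X => by
      refine LinearMap.ext fun A => ?_
      simp only [LinearMap.neg_apply, LinearMap.add_apply, LinearMap.comp_apply,
        LinearMap.smul_apply, LinearMap.mulLeft_apply, map_smul, smul_mul_assoc, smul_neg, smul_add])
    (fun Ω X Y => by
      refine LinearMap.ext fun A => ?_
      simp only [LinearMap.neg_apply, LinearMap.add_apply, LinearMap.comp_apply,
        LinearMap.mulLeft_apply, Prod.fst_add, Prod.snd_add, evenInterior_add, oddInterior_add,
        mul_add]
      abel)
    (fun c Ω X => by
      refine LinearMap.ext fun A => ?_
      simp only [LinearMap.neg_apply, LinearMap.add_apply, LinearMap.comp_apply,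
        LinearMap.smul_apply, LinearMap.mulLeft_apply, Prod.smul_fst, Prod.smul_snd,
        evenInterior_smul, oddInterior_smul, mul_smul_comm, smul_neg, smul_add]))

/-- An element of `E^2(g) ⊗ g` as a bilinear map `g × g → g`:
`(Ω ⊗ X)(Y, Z) = Ω(Y, Z) X`. -/
def toBilin (t : SuperExt V₀ V₁ ⊗[ℂ] (V₀ × V₁)) (Y Z : V₀ × V₁) : V₀ × V₁ :=
  TensorProduct.lid ℂ (V₀ × V₁) (LinearMap.rTensor (V₀ × V₁) (eval 2 ![Y, Z]) t)

/-- `d = D_F`: the endomorphism `d` of `E(g)` corresponds to the bilinear map `F` on `g`, that is,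
`d` is the image under `superD` of an element of `E^2(g) ⊗ g` that represents `F`. If `F` is a Lie
superalgebra structure, then `d` is the super-exterior differential of `(g, F)`. -/
def IsDifferential (F : V₀ × V₁ →ₗ[ℂ] V₀ × V₁ →ₗ[ℂ] V₀ × V₁)
    (d : SuperExt V₀ V₁ →ₗ[ℂ] SuperExt V₀ V₁) : Prop :=
  ∃ t : degree V₀ V₁ 2 ⊗[ℂ] (V₀ × V₁),
    (∀ Y Z, toBilin (LinearMap.rTensor (V₀ × V₁) (degree V₀ V₁ 2).subtype t) Y Z = F Y Z) ∧
      superD (LinearMap.rTensor (V₀ × V₁) (degree V₀ V₁ 2).subtype t) = d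

end Differential

end QuadSuper

end

/-!
Both sides of `d = -ad_P(I)` are built from contractions: `{A, A'}` is, up to signs, the sum of the
products `ι_e(A) ∧ ι_{e'}(A')` over an adapted basis `e` and its `B`-dual basis `e'`, so
`-ad_P(I) = D_F` for the bracket `F` with `B(F(X, Y), Z) = I(X, Y, Z)`. Contractions are
super-derivations of the Poisson bracket, so four of them turn `{I, I}` into twice the Jacobiator
of `F` paired with the last vector; by Euler's formula an element of positive degree vanishes as
soon as its contractions do, hence `{I, I} = 0` is exactly the Jacobi identity. Conversely the form
`B([X, Y], Z)` of an invariant bracket is super-antisymmetric, and its coordinate expansion in an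
adapted basis exhibits it as the form of an element of `E^{(3,0)}(g)`.
-/

open scoped TensorProduct DirectSum

noncomputable section

namespace QuadSuper

section Factors

variable {V₀ V₁ : Type*} [AddCommGroup V₀] [Module ℂ V₀] [AddCommGroup V₁] [Module ℂ V₁]

theorem altSign_mul (Ω Ω' : Alt V₀) : altSign V₀ (Ω * Ω') = altSign V₀ Ω * altSign V₀ Ω' :=
  map_mul (CliffordAlgebra.involute : Alt V₀ →ₐ[ℂ] Alt V₀) Ω Ω'

theorem altSign_ι (α : Module.Dual ℂ V₀) :
    altSign V₀ (ExteriorAlgebra.ι ℂ α) = -ExteriorAlgebra.ι ℂ α :=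
  CliffordAlgebra.involute_ι α

theorem altSign_algebraMap (r : ℂ) :
    altSign V₀ (algebraMap ℂ (Alt V₀) r) = algebraMap ℂ (Alt V₀) r :=
  AlgHom.commutes (CliffordAlgebra.involute : Alt V₀ →ₐ[ℂ] Alt V₀) r

theorem altSign_altSign (Ω : Alt V₀) : altSign V₀ (altSign V₀ Ω) = Ω :=
  CliffordAlgebra.involute_involute Ω

theorem symSign_mul (F G : Sym V₁) : symSign V₁ (F * G) = symSign V₁ F * symSign V₁ G :=
  map_mul (SymmetricAlgebra.lift (-(SymmetricAlgebra.ι ℂ (Module.Dual ℂ V₁))) :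
    Sym V₁ →ₐ[ℂ] Sym V₁) F G

theorem symSign_ι (p : Module.Dual ℂ V₁) :
    symSign V₁ (SymmetricAlgebra.ι ℂ _ p) = -SymmetricAlgebra.ι ℂ _ p := by
  simp [symSign]

theorem symSign_algebraMap (r : ℂ) :
    symSign V₁ (algebraMap ℂ (Sym V₁) r) = algebraMap ℂ (Sym V₁) r :=
  AlgHom.commutes (SymmetricAlgebra.lift (-(SymmetricAlgebra.ι ℂ (Module.Dual ℂ V₁))) :
    Sym V₁ →ₐ[ℂ] Sym V₁) r

theorem symSign_symSign (F : Sym V₁) : symSign V₁ (symSign V₁ F) = F := by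
  induction F using SymmetricAlgebra.induction with
  | algebraMap r => simp only [symSign_algebraMap]
  | ι p => simp only [symSign_ι, map_neg, neg_neg]
  | mul F G hF hG => rw [symSign_mul, symSign_mul, hF, hG]
  | add F G hF hG => rw [map_add, map_add, hF, hG]

theorem altInterior_algebraMap (X : V₀) (r : ℂ) :
    altInterior X (algebraMap ℂ (Alt V₀) r) = 0 :=
  CliffordAlgebra.contractLeft_algebraMap _ _ _

theorem altInterior_ι (X : V₀) (α : Module.Dual ℂ V₀) :
    altInterior X (ExteriorAlgebra.ι ℂ α) = algebraMap ℂ (Alt V₀) (α X) :=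
  CliffordAlgebra.contractLeft_ι _ _ _

theorem altInterior_ι_mul (X : V₀) (α : Module.Dual ℂ V₀) (Ω : Alt V₀) :
    altInterior X (ExteriorAlgebra.ι ℂ α * Ω) =
      α X • Ω - ExteriorAlgebra.ι ℂ α * altInterior X Ω :=
  CliffordAlgebra.contractLeft_ι_mul _ _ _

theorem altInterior_anticomm (X Y : V₀) (Ω : Alt V₀) :
    altInterior X (altInterior Y Ω) = -altInterior Y (altInterior X Ω) :=
  CliffordAlgebra.contractLeft_comm _ _ _

theorem alt_left_induction {P : Alt V₀ → Prop} (algebraMap : ∀ r, P (algebraMap ℂ (Alt V₀) r))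
    (add : ∀ Ω Ω', P Ω → P Ω' → P (Ω + Ω'))
    (ι_mul : ∀ Ω α, P Ω → P (ExteriorAlgebra.ι ℂ α * Ω)) (Ω : Alt V₀) : P Ω :=
  CliffordAlgebra.left_induction (0 : QuadraticForm ℂ (Module.Dual ℂ V₀)) algebraMap add ι_mul Ω

theorem altInterior_altSign (X : V₀) (Ω : Alt V₀) :
    altInterior X (altSign V₀ Ω) = -altSign V₀ (altInterior X Ω) := by
  induction Ω using alt_left_induction with
  | algebraMap r => rw [altSign_algebraMap, altInterior_algebraMap, map_zero, neg_zero]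
  | add Ω Ω' h h' => simp only [map_add, h, h', neg_add]
  | ι_mul Ω α h =>
    simp only [altSign_mul, altSign_ι, neg_mul, map_neg, altInterior_ι_mul, h, map_sub, map_smul,
      mul_neg, sub_neg_eq_add]

theorem altInterior_mul (X : V₀) (Ω Ω' : Alt V₀) :
    altInterior X (Ω * Ω') = altInterior X Ω * Ω' + altSign V₀ Ω * altInterior X Ω' := by
  induction Ω using alt_left_induction with
  | algebraMap r =>
    rw [altSign_algebraMap, altInterior_algebraMap, ← Algebra.smul_def, ← Algebra.smul_def,
      map_smul, zero_mul, zero_add]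
  | add Ω₁ Ω₂ h₁ h₂ => simp only [map_add, add_mul, h₁, h₂]; abel
  | ι_mul Ω α h =>
    rw [mul_assoc, altInterior_ι_mul, altInterior_ι_mul, h, altSign_mul, altSign_ι]
    noncomm_ring

theorem symDeriv_symSign (X : V₁) (F : Sym V₁) :
    symDeriv X (symSign V₁ F) = -symSign V₁ (symDeriv X F) := by
  induction F using SymmetricAlgebra.induction with
  | algebraMap r => simp only [symSign_algebraMap, Derivation.map_algebraMap, map_zero, neg_zero]
  | ι p => simp only [symSign_ι, map_neg, symDeriv_ι, symSign_algebraMap]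
  | mul F G hF hG =>
    simp only [symSign_mul, Derivation.leibniz, hF, hG, smul_eq_mul, map_add]; ring
  | add F G hF hG => simp only [map_add, hF, hG, neg_add]

theorem symDeriv_comm (X Y : V₁) (F : Sym V₁) :
    symDeriv X (symDeriv Y F) = symDeriv Y (symDeriv X F) := by
  induction F using SymmetricAlgebra.induction with
  | algebraMap r => simp only [Derivation.map_algebraMap, map_zero]
  | ι p => simp only [symDeriv_ι, Derivation.map_algebraMap]
  | mul F G hF hG =>
    simp only [Derivation.leibniz, hF, hG, smul_eq_mul, map_add]; ring
  | add F G hF hG => simp only [map_add, hF, hG]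

theorem altSign_of_mem {ω : ℕ} {Ω : Alt V₀} (h : Ω ∈ altPow V₀ ω) :
    altSign V₀ Ω = (-1 : ℂ) ^ ω • Ω := by
  induction h using Submodule.pow_induction_on_left' with
  | algebraMap r => rw [altSign_algebraMap, pow_zero, one_smul]
  | add Ω Ω' _ _ _ h h' => rw [map_add, h, h', smul_add]
  | mem_mul _ hι _ Ω _ h =>
    obtain ⟨α, rfl⟩ := hι
    rw [altSign_mul, altSign_ι, h, pow_succ, mul_neg_one, neg_smul, neg_mul, mul_smul_comm]

theorem symSign_of_mem {f : ℕ} {F : Sym V₁} (h : F ∈ symPow V₁ f) :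
    symSign V₁ F = (-1 : ℂ) ^ f • F := by
  unfold symPow at h
  induction h using Submodule.pow_induction_on_left' with
  | algebraMap r => rw [symSign_algebraMap, pow_zero, one_smul]
  | add F G _ _ _ h h' => rw [map_add, h, h', smul_add]
  | mem_mul _ hι _ F _ h =>
    obtain ⟨p, rfl⟩ := hι
    rw [symSign_mul, symSign_ι, h, pow_succ, mul_neg_one, neg_smul, neg_mul, mul_smul_comm]

theorem ι_mul_mem_altPow (α : Module.Dual ℂ V₀) {ω : ℕ} {Ω : Alt V₀} (h : Ω ∈ altPow V₀ ω) :
    ExteriorAlgebra.ι ℂ α * Ω ∈ altPow V₀ (ω + 1) := by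
  change _ ∈ LinearMap.range (ExteriorAlgebra.ι ℂ) ^ (ω + 1)
  rw [pow_succ']
  exact Submodule.mul_mem_mul (LinearMap.mem_range_self _ _) h

theorem ι_mul_mem_symPow (p : Module.Dual ℂ V₁) {f : ℕ} {F : Sym V₁} (h : F ∈ symPow V₁ f) :
    SymmetricAlgebra.ι ℂ _ p * F ∈ symPow V₁ (f + 1) := by
  rw [symPow, pow_succ']
  exact Submodule.mul_mem_mul (LinearMap.mem_range_self _ _) h

theorem altInterior_eq_zero_of_mem (X : V₀) {Ω : Alt V₀} (h : Ω ∈ altPow V₀ 0) :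
    altInterior X Ω = 0 := by
  obtain ⟨r, rfl⟩ := Submodule.mem_one.mp (by simpa only [pow_zero] using h)
  exact altInterior_algebraMap X r

theorem symDeriv_eq_zero_of_mem (X : V₁) {F : Sym V₁} (h : F ∈ symPow V₁ 0) :
    symDeriv X F = 0 := by
  obtain ⟨r, rfl⟩ := Submodule.mem_one.mp (by simpa only [symPow, pow_zero] using h)
  exact Derivation.map_algebraMap _ r

theorem ι_mul_altInterior_mem (X : V₀) {ω : ℕ} {Ω : Alt V₀} (h : Ω ∈ altPow V₀ ω)
    (α : Module.Dual ℂ V₀) : ExteriorAlgebra.ι ℂ α * altInterior X Ω ∈ altPow V₀ ω := by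
  induction h using Submodule.pow_induction_on_left' generalizing α with
  | algebraMap r => rw [altInterior_algebraMap, mul_zero]; exact zero_mem _
  | add Ω Ω' _ _ _ h h' => rw [map_add, mul_add]; exact add_mem (h α) (h' α)
  | mem_mul _ hι _ Ω hΩ h =>
    obtain ⟨β, rfl⟩ := hι
    rw [altInterior_ι_mul, mul_sub, mul_smul_comm]
    exact sub_mem (Submodule.smul_mem _ _ (ι_mul_mem_altPow α hΩ)) (ι_mul_mem_altPow α (h β))

theorem ι_mul_symDeriv_mem (X : V₁) {f : ℕ} {F : Sym V₁} (h : F ∈ symPow V₁ f)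
    (p : Module.Dual ℂ V₁) : SymmetricAlgebra.ι ℂ _ p * symDeriv X F ∈ symPow V₁ f := by
  unfold symPow at h
  induction h using Submodule.pow_induction_on_left' generalizing p with
  | algebraMap r => rw [Derivation.map_algebraMap, mul_zero]; exact zero_mem _
  | add F G _ _ _ h h' => rw [map_add, mul_add]; exact add_mem (h p) (h' p)
  | mem_mul _ hι _ F hF h =>
    obtain ⟨q, rfl⟩ := hι
    rw [Derivation.leibniz, symDeriv_ι, smul_eq_mul, smul_eq_mul, mul_comm F, ← Algebra.smul_def,
      mul_add, mul_smul_comm]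
    exact add_mem (ι_mul_mem_symPow p (h q)) (Submodule.smul_mem _ _ (ι_mul_mem_symPow p hF))

theorem altInterior_mem (X : V₀) {ω : ℕ} {Ω : Alt V₀} (h : Ω ∈ altPow V₀ (ω + 1)) :
    altInterior X Ω ∈ altPow V₀ ω := by
  change Ω ∈ LinearMap.range (ExteriorAlgebra.ι ℂ) ^ (ω + 1) at h
  rw [pow_succ'] at h
  induction h using Submodule.mul_induction_on' with
  | add Ω _ Ω' _ h h' => rw [map_add]; exact add_mem h h'
  | mem_mul_mem _ hι Ω hΩ =>
    obtain ⟨α, rfl⟩ := hι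
    rw [altInterior_ι_mul]
    exact sub_mem (Submodule.smul_mem _ _ hΩ) (ι_mul_altInterior_mem X hΩ α)

theorem symDeriv_mem (X : V₁) {f : ℕ} {F : Sym V₁} (h : F ∈ symPow V₁ (f + 1)) :
    symDeriv X F ∈ symPow V₁ f := by
  rw [symPow, pow_succ'] at h
  induction h using Submodule.mul_induction_on' with
  | add F _ G _ h h' => rw [map_add]; exact add_mem h h'
  | mem_mul_mem _ hι F hF =>
    obtain ⟨p, rfl⟩ := hι
    rw [Derivation.leibniz, symDeriv_ι, smul_eq_mul, smul_eq_mul, mul_comm F, ← Algebra.smul_def]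
    exact add_mem (ι_mul_symDeriv_mem X hF p) (Submodule.smul_mem _ _ hF)

theorem sum_ι_mul_altInterior {κ : Type*} [Fintype κ] (e : Module.Basis κ ℂ V₀) {ω : ℕ}
    {Ω : Alt V₀} (h : Ω ∈ altPow V₀ ω) :
    ∑ j, ExteriorAlgebra.ι ℂ (e.coord j) * altInterior (e j) Ω = (ω : ℂ) • Ω := by
  induction h using Submodule.pow_induction_on_left' with
  | algebraMap r => simp [altInterior_algebraMap]
  | add Ω Ω' _ _ _ h h' =>
    simp only [map_add, mul_add, Finset.sum_add_distrib, h, h', smul_add]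
  | mem_mul _ hι ω Ω _ h =>
    obtain ⟨α, rfl⟩ := hι
    have anticomm (β : Module.Dual ℂ V₀) : ExteriorAlgebra.ι ℂ β * ExteriorAlgebra.ι ℂ α =
        -(ExteriorAlgebra.ι ℂ α * ExteriorAlgebra.ι ℂ β) :=
      eq_neg_of_add_eq_zero_left (ExteriorAlgebra.ι_add_mul_swap β α)
    have expand : ∑ j, α (e j) • ExteriorAlgebra.ι ℂ (e.coord j) = ExteriorAlgebra.ι ℂ α := by
      simp only [← map_smul, ← map_sum, e.sum_dual_apply_smul_coord]
    calc ∑ j, ExteriorAlgebra.ι ℂ (e.coord j) * altInterior (e j) (ExteriorAlgebra.ι ℂ α * Ω)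
        = (∑ j, α (e j) • ExteriorAlgebra.ι ℂ (e.coord j)) * Ω + ExteriorAlgebra.ι ℂ α *
            ∑ j, ExteriorAlgebra.ι ℂ (e.coord j) * altInterior (e j) Ω := by
          simp only [altInterior_ι_mul, mul_sub, mul_smul_comm, ← mul_assoc, anticomm, neg_mul,
            sub_neg_eq_add, Finset.sum_add_distrib, Finset.sum_mul, Finset.mul_sum,
            smul_mul_assoc]
      _ = ((ω + 1 : ℕ) : ℂ) • (ExteriorAlgebra.ι ℂ α * Ω) := by
          rw [expand, h, mul_smul_comm, Nat.cast_succ, add_smul, one_smul, add_comm]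

theorem sum_ι_mul_symDeriv {κ : Type*} [Fintype κ] (e : Module.Basis κ ℂ V₁) {f : ℕ}
    {F : Sym V₁} (h : F ∈ symPow V₁ f) :
    ∑ j, SymmetricAlgebra.ι ℂ _ (e.coord j) * symDeriv (e j) F = (f : ℂ) • F := by
  unfold symPow at h
  induction h using Submodule.pow_induction_on_left' with
  | algebraMap r => simp
  | add F G _ _ _ h h' =>
    simp only [map_add, mul_add, Finset.sum_add_distrib, h, h', smul_add]
  | mem_mul _ hι f F _ h =>
    obtain ⟨p, rfl⟩ := hι
    have expand : ∑ j, p (e j) • SymmetricAlgebra.ι ℂ _ (e.coord j) =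
        SymmetricAlgebra.ι ℂ _ p := by
      simp only [← map_smul, ← map_sum, e.sum_dual_apply_smul_coord]
    calc ∑ j, SymmetricAlgebra.ι ℂ _ (e.coord j) *
          symDeriv (e j) (SymmetricAlgebra.ι ℂ _ p * F)
        = (∑ j, p (e j) • SymmetricAlgebra.ι ℂ _ (e.coord j)) * F + SymmetricAlgebra.ι ℂ _ p *
            ∑ j, SymmetricAlgebra.ι ℂ _ (e.coord j) * symDeriv (e j) F := by
          rw [Finset.sum_mul, Finset.mul_sum, ← Finset.sum_add_distrib]
          refine Finset.sum_congr rfl fun j _ => ?_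
          rw [Derivation.leibniz, symDeriv_ι, smul_eq_mul, smul_eq_mul, Algebra.smul_def]
          ring
      _ = ((f + 1 : ℕ) : ℂ) • (SymmetricAlgebra.ι ℂ _ p * F) := by
          rw [expand, h, mul_smul_comm, Nat.cast_succ, add_smul, one_smul, add_comm]

end Factors

section Parity

variable {V₀ V₁ : Type*} [AddCommGroup V₀] [Module ℂ V₀] [AddCommGroup V₁] [Module ℂ V₁]

theorem zmod_two_cases (x : ZMod 2) : x = 0 ∨ x = 1 := by
  revert x; decide

theorem mem_part_cases {x : ZMod 2} {X : V₀ × V₁} (hX : X ∈ part V₀ V₁ x) :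
    (x = 0 ∧ ∃ X₀, X = (X₀, 0)) ∨ (x = 1 ∧ ∃ X₁, X = (0, X₁)) := by
  obtain rfl | rfl := zmod_two_cases x
  · rw [part, if_pos rfl] at hX
    obtain ⟨X₀, rfl⟩ := hX
    exact .inl ⟨rfl, X₀, rfl⟩
  · rw [part, if_neg one_ne_zero] at hX
    obtain ⟨X₁, rfl⟩ := hX
    exact .inr ⟨rfl, X₁, rfl⟩

theorem even_mem_part (X : V₀) : ((X, 0) : V₀ × V₁) ∈ part V₀ V₁ 0 := by
  simp [part]

theorem odd_mem_part (Y : V₁) : ((0, Y) : V₀ × V₁) ∈ part V₀ V₁ 1 := by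
  simp [part]

theorem linearMap_ext_part {M : Type*} [AddCommGroup M] [Module ℂ M] {φ ψ : V₀ × V₁ →ₗ[ℂ] M}
    (h : ∀ x, ∀ X ∈ part V₀ V₁ x, φ X = ψ X) : φ = ψ :=
  LinearMap.prod_ext (LinearMap.ext fun X => h 0 _ (even_mem_part X))
    (LinearMap.ext fun Y => h 1 _ (odd_mem_part Y))

theorem sgn_zero_left (y : ZMod 2) : sgn 0 y = 1 := by simp [sgn]

theorem sgn_zero_right (x : ZMod 2) : sgn x 0 = 1 := by simp [sgn]

theorem sgn_one_one : sgn 1 1 = -1 := by simp [sgn, ZMod.val_one]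

theorem sgn_comm (x y : ZMod 2) : sgn x y = sgn y x := by rw [sgn, sgn, mul_comm]

theorem sgn_add_right (x y z : ZMod 2) : sgn x (y + z) = sgn x y * sgn x z := by
  have one_add_one : (1 : ZMod 2) + 1 = 0 := rfl
  rcases zmod_two_cases x with rfl | rfl <;> rcases zmod_two_cases y with rfl | rfl <;>
    rcases zmod_two_cases z with rfl | rfl <;>
    simp [sgn_zero_left, sgn_zero_right, sgn_one_one, one_add_one]

theorem sgn_mul_self (x y : ZMod 2) : sgn x y * sgn x y = 1 := by
  rw [sgn, ← pow_add, ← two_mul, pow_mul]; simp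

end Parity

section SuperExterior

variable {V₀ V₁ : Type*} [AddCommGroup V₀] [Module ℂ V₀] [AddCommGroup V₁] [Module ℂ V₁]

theorem mapTensor_tmul (u : Alt V₀ →ₗ[ℂ] Alt V₀) (v : Sym V₁ →ₗ[ℂ] Sym V₁) (Ω : Alt V₀)
    (F : Sym V₁) :
    mapTensor V₀ V₁ u v (ofTensor V₀ V₁ (Ω ⊗ₜ[ℂ] F)) = ofTensor V₀ V₁ (u Ω ⊗ₜ[ℂ] v F) := rfl

theorem superExt_induction {P : SuperExt V₀ V₁ → Prop}
    (tmul : ∀ (ω f : ℕ), ∀ Ω ∈ altPow V₀ ω, ∀ F ∈ symPow V₁ f, P (ofTensor V₀ V₁ (Ω ⊗ₜ[ℂ] F)))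
    (add : ∀ A A', P A → P A' → P (A + A')) (A : SuperExt V₀ V₁) : P A := by
  obtain ⟨T, rfl⟩ := (ofTensor V₀ V₁).surjective A
  have hzero : P 0 := by
    have := tmul 0 0 0 (zero_mem _) 0 (zero_mem _)
    rwa [TensorProduct.zero_tmul, map_zero] at this
  induction T using TensorProduct.induction_on with
  | zero => rwa [map_zero]
  | add S T hS hT => rw [map_add]; exact add _ _ hS hT
  | tmul Ω F =>
    induction Ω using DirectSum.Decomposition.inductionOn (fun i : ℕ => altPow V₀ i) with
    | zero => rwa [TensorProduct.zero_tmul, map_zero]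
    | add Ω Ω' h h' => rw [TensorProduct.add_tmul, map_add]; exact add _ _ h h'
    | homogeneous Ω =>
      induction F using DirectSum.Decomposition.inductionOn (symPow V₁) with
      | zero => rwa [TensorProduct.tmul_zero, map_zero]
      | add F F' h h' => rw [TensorProduct.tmul_add, map_add]; exact add _ _ h h'
      | homogeneous F => exact tmul _ _ _ Ω.2 _ F.2

theorem altSign_pow_of_mem (k : ℕ) {ω : ℕ} {Ω : Alt V₀} (hΩ : Ω ∈ altPow V₀ ω) :
    (altSign V₀ ^ k) Ω = (-1 : ℂ) ^ (k * ω) • Ω := by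
  induction k with
  | zero => simp
  | succ k ih =>
    rw [pow_succ', Module.End.mul_apply, ih, map_smul, altSign_of_mem hΩ, smul_smul,
      ← pow_add, Nat.succ_mul]

theorem altSign_pow_altSign (f : ℕ) (Ω : Alt V₀) :
    (altSign V₀ ^ f) (altSign V₀ Ω) = altSign V₀ ((altSign V₀ ^ f) Ω) := by
  rw [← Module.End.mul_apply, ← Module.End.mul_apply, ← pow_succ, ← pow_succ']

theorem altInterior_altSign_pow (X : V₀) (f : ℕ) (Ω : Alt V₀) :
    altInterior X ((altSign V₀ ^ f) Ω) = (-1 : ℂ) ^ f • (altSign V₀ ^ f) (altInterior X Ω) := by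
  induction f with
  | zero => simp
  | succ f ih =>
    rw [pow_succ', Module.End.mul_apply, altInterior_altSign, ih, map_smul, Module.End.mul_apply,
      pow_succ', neg_one_mul, neg_smul]

theorem symSign_mem {f : ℕ} {F : Sym V₁} (hF : F ∈ symPow V₁ f) : symSign V₁ F ∈ symPow V₁ f := by
  rw [symSign_of_mem hF]
  exact Submodule.smul_mem _ _ hF

theorem tmul_mul_tmul {f : ℕ} (Ω : Alt V₀) {F : Sym V₁} (hF : F ∈ symPow V₁ f) (Ω' : Alt V₀)
    (F' : Sym V₁) :
    ofTensor V₀ V₁ (Ω ⊗ₜ[ℂ] F) * ofTensor V₀ V₁ (Ω' ⊗ₜ[ℂ] F') =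
      ofTensor V₀ V₁ ((Ω * (altSign V₀ ^ f) Ω') ⊗ₜ[ℂ] (F * F')) := by
  induction Ω' using DirectSum.Decomposition.inductionOn (fun i : ℕ => altPow V₀ i) with
  | zero => simp only [TensorProduct.zero_tmul, map_zero, mul_zero]
  | add Ω₁ Ω₂ h₁ h₂ => simp only [TensorProduct.add_tmul, map_add, mul_add, h₁, h₂]
  | homogeneous Ω' =>
    rw [altSign_pow_of_mem f Ω'.2]
    refine (GradedTensorProduct.tmul_coe_mul_coe_tmul (R := ℂ) (fun i : ℕ => altPow V₀ i)
      (symPow V₁) Ω ⟨F, hF⟩ Ω' F').trans ?_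
    rw [Units.smul_def, ← Int.cast_smul_eq_zsmul ℂ, mul_smul_comm, ← TensorProduct.smul_tmul',
      map_smul]
    congr 1
    push_cast [uzpow_natCast]
    simp

/-- `A ↦ (-1)^n A` for `A ∈ E^n(g)`. -/
def totalSign : SuperExt V₀ V₁ →ₗ[ℂ] SuperExt V₀ V₁ :=
  mapTensor V₀ V₁ (altSign V₀) (symSign V₁)

/-- `A ↦ (-1)^{xb} A` for `A ∈ E^{(n,b)}(g)`: the sign of moving a vector of parity `x` past `A`. -/
def parityTwist (x : ZMod 2) : SuperExt V₀ V₁ →ₗ[ℂ] SuperExt V₀ V₁ :=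
  paritySign V₀ V₁ ^ x.val

variable (V₀ V₁) in
/-- The contraction `A ↦ A(X, ·, …, ·)` of forms by their first argument, which differs from the
interior product `ι_X` by the sign `(-1)^{xb}`. -/
def contr : V₀ × V₁ →ₗ[ℂ] SuperExt V₀ V₁ →ₗ[ℂ] SuperExt V₀ V₁ :=
  LinearMap.mk₂ ℂ (fun X A => evenInterior X.1 A + oddInterior X.2 (paritySign V₀ V₁ A))
    (fun X Y A => by
      simp only [Prod.fst_add, Prod.snd_add, evenInterior_add, oddInterior_add]; abel)
    (fun c X A => by
      simp only [Prod.smul_fst, Prod.smul_snd, evenInterior_smul, oddInterior_smul, smul_add])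
    (fun X A A' => by simp only [map_add]; abel)
    (fun c X A => by simp only [map_smul, smul_add])

theorem totalSign_tmul (Ω : Alt V₀) (F : Sym V₁) :
    totalSign (ofTensor V₀ V₁ (Ω ⊗ₜ[ℂ] F)) =
      ofTensor V₀ V₁ (altSign V₀ Ω ⊗ₜ[ℂ] symSign V₁ F) := rfl

theorem paritySign_tmul (Ω : Alt V₀) (F : Sym V₁) :
    paritySign V₀ V₁ (ofTensor V₀ V₁ (Ω ⊗ₜ[ℂ] F)) = ofTensor V₀ V₁ (Ω ⊗ₜ[ℂ] symSign V₁ F) := rfl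

theorem parityTwist_zero (A : SuperExt V₀ V₁) : parityTwist 0 A = A := rfl

theorem parityTwist_one (A : SuperExt V₀ V₁) : parityTwist 1 A = paritySign V₀ V₁ A :=
  LinearMap.congr_fun (pow_one (paritySign V₀ V₁)) A

theorem contr_tmul (X : V₀ × V₁) (Ω : Alt V₀) (F : Sym V₁) :
    contr V₀ V₁ X (ofTensor V₀ V₁ (Ω ⊗ₜ[ℂ] F)) = ofTensor V₀ V₁ (altInterior X.1 Ω ⊗ₜ[ℂ] F) +
      ofTensor V₀ V₁ (altSign V₀ Ω ⊗ₜ[ℂ] symSign V₁ (symDeriv X.2 F)) := by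
  rw [← neg_neg (symSign V₁ (symDeriv X.2 F)), ← symDeriv_symSign]
  rfl

theorem contr_even_tmul (X : V₀) (Ω : Alt V₀) (F : Sym V₁) :
    contr V₀ V₁ (X, 0) (ofTensor V₀ V₁ (Ω ⊗ₜ[ℂ] F)) =
      ofTensor V₀ V₁ (altInterior X Ω ⊗ₜ[ℂ] F) := by
  have symDeriv_zero : symDeriv (0 : V₁) F = 0 := by simpa using symDeriv_add_smul 1 (0 : V₁) 0 F
  rw [contr_tmul, symDeriv_zero, map_zero, TensorProduct.tmul_zero, map_zero, add_zero]

theorem contr_odd_tmul (Y : V₁) (Ω : Alt V₀) (F : Sym V₁) :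
    contr V₀ V₁ (0, Y) (ofTensor V₀ V₁ (Ω ⊗ₜ[ℂ] F)) =
      ofTensor V₀ V₁ (altSign V₀ Ω ⊗ₜ[ℂ] symSign V₁ (symDeriv Y F)) := by
  have altInterior_zero : altInterior (0 : V₀) Ω = 0 := by
    rw [altInterior, map_zero, map_zero, LinearMap.zero_apply]
  rw [contr_tmul, altInterior_zero, TensorProduct.zero_tmul, map_zero, zero_add]

theorem contr_odd_tmul_mul_tmul (Y : V₁) {f : ℕ} (Ω : Alt V₀) {F : Sym V₁}
    (hF : F ∈ symPow V₁ f) (Ω' : Alt V₀) (F' : Sym V₁) :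
    contr V₀ V₁ (0, Y) (ofTensor V₀ V₁ (Ω ⊗ₜ[ℂ] F)) * ofTensor V₀ V₁ (Ω' ⊗ₜ[ℂ] F') =
      ofTensor V₀ V₁ (altSign V₀ (Ω * (altSign V₀ ^ f) Ω') ⊗ₜ[ℂ]
        (symSign V₁ (symDeriv Y F) * F')) := by
  rw [contr_odd_tmul]
  cases f with
  | zero =>
    simp only [symDeriv_eq_zero_of_mem Y hF, map_zero, TensorProduct.tmul_zero, zero_mul]
  | succ f =>
    rw [tmul_mul_tmul _ (symSign_mem (symDeriv_mem Y hF)), pow_succ', Module.End.mul_apply,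
      altSign_mul, altSign_altSign]

theorem paritySign_paritySign (A : SuperExt V₀ V₁) :
    paritySign V₀ V₁ (paritySign V₀ V₁ A) = A := by
  induction A using superExt_induction with
  | tmul _ _ _ _ _ _ => simp only [paritySign_tmul, symSign_symSign]
  | add A A' h h' => rw [map_add, map_add, h, h']

theorem parityTwist_comm (x y : ZMod 2) (A : SuperExt V₀ V₁) :
    parityTwist x (parityTwist y A) = parityTwist y (parityTwist x A) := by
  rw [parityTwist, parityTwist, ← Module.End.mul_apply, ← Module.End.mul_apply, ← pow_add,
    ← pow_add, add_comm]

theorem contr_totalSign (X : V₀ × V₁) (A : SuperExt V₀ V₁) :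
    contr V₀ V₁ X (totalSign A) = -totalSign (contr V₀ V₁ X A) := by
  induction A using superExt_induction with
  | tmul _ _ _ _ _ _ =>
    simp only [contr_tmul, totalSign_tmul, map_add, altInterior_altSign, symDeriv_symSign, map_neg,
      TensorProduct.neg_tmul, TensorProduct.tmul_neg, neg_add]
  | add A A' h h' => simp only [map_add, h, h', neg_add]

theorem contr_parityTwist (x : ZMod 2) {y : ZMod 2} {Y : V₀ × V₁} (hY : Y ∈ part V₀ V₁ y)
    (A : SuperExt V₀ V₁) :
    contr V₀ V₁ Y (parityTwist x A) = sgn x y • parityTwist x (contr V₀ V₁ Y A) := by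
  obtain rfl | rfl := zmod_two_cases x
  · rw [sgn_zero_left, one_smul, parityTwist_zero, parityTwist_zero]
  induction A using superExt_induction with
  | add A A' h h' => simp only [map_add, h, h', smul_add]
  | tmul _ _ _ _ _ _ =>
    obtain ⟨rfl, Y, rfl⟩ | ⟨rfl, Y, rfl⟩ := mem_part_cases hY
    · simp only [parityTwist_one, paritySign_tmul, contr_even_tmul, sgn_zero_right, one_smul]
    · simp only [parityTwist_one, paritySign_tmul, contr_odd_tmul, sgn_one_one, symDeriv_symSign,
        map_neg, TensorProduct.tmul_neg, neg_smul, one_smul]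

theorem contr_supercomm {x y : ZMod 2} {X Y : V₀ × V₁} (hX : X ∈ part V₀ V₁ x)
    (hY : Y ∈ part V₀ V₁ y) (A : SuperExt V₀ V₁) :
    contr V₀ V₁ X (contr V₀ V₁ Y A) = -sgn x y • contr V₀ V₁ Y (contr V₀ V₁ X A) := by
  induction A using superExt_induction with
  | add A A' h h' => simp only [map_add, h, h', smul_add]
  | tmul _ _ _ _ _ _ =>
    obtain ⟨rfl, X, rfl⟩ | ⟨rfl, X, rfl⟩ := mem_part_cases hX <;>
    obtain ⟨rfl, Y, rfl⟩ | ⟨rfl, Y, rfl⟩ := mem_part_cases hY <;>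
    simp only [contr_even_tmul, contr_odd_tmul, sgn_zero_left, sgn_zero_right, sgn_one_one,
      altInterior_anticomm X, altInterior_altSign, symDeriv_symSign, symDeriv_comm X, map_neg,
      TensorProduct.neg_tmul, neg_smul, one_smul, neg_neg]

theorem contr_mul {x : ZMod 2} {X : V₀ × V₁} (hX : X ∈ part V₀ V₁ x) (A A' : SuperExt V₀ V₁) :
    contr V₀ V₁ X (A * A') =
      contr V₀ V₁ X A * parityTwist x A' + totalSign A * contr V₀ V₁ X A' := by
  induction A using superExt_induction with
  | add A₁ A₂ h₁ h₂ => simp only [add_mul, map_add, h₁, h₂]; abel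
  | tmul _ _ _ _ _ hF =>
    induction A' using superExt_induction with
    | add A₁ A₂ h₁ h₂ => simp only [mul_add, map_add, h₁, h₂]; abel
    | tmul _ _ _ _ F' _ =>
      obtain ⟨rfl, X, rfl⟩ | ⟨rfl, X, rfl⟩ := mem_part_cases hX
      · simp only [parityTwist_zero, tmul_mul_tmul _ hF, contr_even_tmul, totalSign_tmul,
          tmul_mul_tmul _ (symSign_mem hF), altInterior_mul, altInterior_altSign_pow,
          TensorProduct.add_tmul, map_add]
        rw [symSign_of_mem hF, mul_smul_comm, smul_mul_assoc, TensorProduct.smul_tmul]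
      · rw [parityTwist_one, paritySign_tmul, contr_odd_tmul_mul_tmul _ _ hF]
        simp only [tmul_mul_tmul _ hF, totalSign_tmul, contr_odd_tmul,
          tmul_mul_tmul _ (symSign_mem hF), Derivation.leibniz, smul_eq_mul, altSign_pow_altSign,
          altSign_mul, map_add, symSign_mul, TensorProduct.tmul_add]
        rw [add_comm, mul_comm (symSign V₁ F')]

end SuperExterior

section Degrees

variable {V₀ V₁ : Type*} [AddCommGroup V₀] [Module ℂ V₀] [AddCommGroup V₁] [Module ℂ V₁]

theorem tensorPart_le {ω f : ℕ} {S : Submodule ℂ (SuperExt V₀ V₁)}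
    (h : ∀ Ω ∈ altPow V₀ ω, ∀ F ∈ symPow V₁ f, ofTensor V₀ V₁ (Ω ⊗ₜ[ℂ] F) ∈ S) :
    tensorPart V₀ V₁ ω f ≤ S := by
  rw [tensorPart, Submodule.span_le]
  rintro _ ⟨Ω, hΩ, F, hF, rfl⟩
  exact h Ω hΩ F hF

theorem tmul_mem_tensorPart {ω f : ℕ} {Ω : Alt V₀} (hΩ : Ω ∈ altPow V₀ ω) {F : Sym V₁}
    (hF : F ∈ symPow V₁ f) : ofTensor V₀ V₁ (Ω ⊗ₜ[ℂ] F) ∈ tensorPart V₀ V₁ ω f :=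
  Submodule.subset_span ⟨Ω, hΩ, F, hF, rfl⟩

theorem tensorPart_le_degree {n ω f : ℕ} (hn : ω + f = n) :
    tensorPart V₀ V₁ ω f ≤ degree V₀ V₁ n :=
  le_iSup_of_le ω (le_iSup_of_le f (le_iSup_of_le hn le_rfl))

theorem tensorPart_le_bidegree {n ω f : ℕ} {b : ZMod 2} (hn : ω + f = n) (hb : (f : ZMod 2) = b) :
    tensorPart V₀ V₁ ω f ≤ bidegree V₀ V₁ n b :=
  le_iSup_of_le ω (le_iSup_of_le f (le_iSup_of_le ⟨hn, hb⟩ le_rfl))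

theorem bidegree_le_degree (n : ℕ) (b : ZMod 2) : bidegree V₀ V₁ n b ≤ degree V₀ V₁ n :=
  iSup_le fun _ => iSup_le fun _ => iSup_le fun hn => tensorPart_le_degree hn.1

theorem tmul_mem_degree {n ω f : ℕ} (hn : ω + f = n) {Ω : Alt V₀} (hΩ : Ω ∈ altPow V₀ ω)
    {F : Sym V₁} (hF : F ∈ symPow V₁ f) : ofTensor V₀ V₁ (Ω ⊗ₜ[ℂ] F) ∈ degree V₀ V₁ n :=
  tensorPart_le_degree hn (tmul_mem_tensorPart hΩ hF)

theorem degree_induction {n : ℕ} {P : ∀ A, A ∈ degree V₀ V₁ n → Prop}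
    (tmul : ∀ ω f (hn : ω + f = n) Ω (hΩ : Ω ∈ altPow V₀ ω) F (hF : F ∈ symPow V₁ f),
      P (ofTensor V₀ V₁ (Ω ⊗ₜ[ℂ] F)) (tmul_mem_degree hn hΩ hF))
    (add : ∀ A A' hA hA', P A hA → P A' hA' → P (A + A') (add_mem hA hA'))
    {A : SuperExt V₀ V₁} (hA : A ∈ degree V₀ V₁ n) : P A hA := by
  let generators : Set (SuperExt V₀ V₁) := {A | ∃ ω f, ω + f = n ∧
    ∃ Ω ∈ altPow V₀ ω, ∃ F ∈ symPow V₁ f, A = ofTensor V₀ V₁ (Ω ⊗ₜ[ℂ] F)}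
  have degree_le : degree V₀ V₁ n ≤ Submodule.span ℂ generators :=
    iSup_le fun ω => iSup_le fun f => iSup_le fun hn => tensorPart_le fun Ω hΩ F hF =>
      Submodule.subset_span ⟨ω, f, hn, Ω, hΩ, F, hF, rfl⟩
  suffices ∃ hA, P A hA from this.2
  refine Submodule.closure_induction (p := fun A _ => ∃ hA, P A hA) ?_ ?_ ?_ (degree_le hA)
  · have hzero := tmul n 0 rfl 0 (zero_mem _) 0 (zero_mem _)
    simp only [TensorProduct.zero_tmul, map_zero] at hzero
    exact ⟨zero_mem _, hzero⟩
  · rintro A A' - - ⟨hA, h⟩ ⟨hA', h'⟩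
    exact ⟨add_mem hA hA', add A A' hA hA' h h'⟩
  · rintro c _ ⟨ω, f, hn, Ω, hΩ, F, hF, rfl⟩
    rw [← map_smul, TensorProduct.smul_tmul']
    exact ⟨_, tmul ω f hn (c • Ω) (Submodule.smul_mem _ c hΩ) F hF⟩

theorem parityTwist_of_mem (x : ZMod 2) {n : ℕ} {b : ZMod 2} {A : SuperExt V₀ V₁}
    (hA : A ∈ bidegree V₀ V₁ n b) : parityTwist x A = sgn x b • A := by
  obtain rfl | rfl := zmod_two_cases x
  · rw [parityTwist_zero, sgn_zero_left, one_smul]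
  suffices bidegree V₀ V₁ n b ≤
      LinearMap.eqLocus (paritySign V₀ V₁) (sgn 1 b • LinearMap.id) by
    rw [parityTwist_one]; exact this hA
  refine iSup_le fun ω => iSup_le fun f => iSup_le fun hn => tensorPart_le fun Ω _ F hF => ?_
  have neg_one_pow_eq_sgn : (-1 : ℂ) ^ f = sgn 1 b := by
    rw [← hn.2, sgn, ZMod.val_one, one_mul, ZMod.val_natCast, ← neg_one_pow_eq_pow_mod_two]
  rw [LinearMap.mem_eqLocus, paritySign_tmul, symSign_of_mem hF, TensorProduct.tmul_smul, map_smul,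
    neg_one_pow_eq_sgn]
  rfl

theorem totalSign_of_mem {n : ℕ} {A : SuperExt V₀ V₁} (hA : A ∈ degree V₀ V₁ n) :
    totalSign A = (-1 : ℂ) ^ n • A := by
  induction hA using degree_induction with
  | add A A' _ _ h h' => rw [map_add, h, h', smul_add]
  | tmul _ _ hn _ hΩ _ hF =>
    rw [totalSign_tmul, symSign_of_mem hF, altSign_of_mem hΩ, TensorProduct.tmul_smul,
      ← TensorProduct.smul_tmul', map_smul, map_smul, smul_smul, ← pow_add, add_comm, hn]

theorem contr_mem (X : V₀ × V₁) {n : ℕ} {A : SuperExt V₀ V₁} (hA : A ∈ degree V₀ V₁ (n + 1)) :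
    contr V₀ V₁ X A ∈ degree V₀ V₁ n := by
  induction hA using degree_induction with
  | add A A' _ _ h h' => rw [map_add]; exact add_mem h h'
  | tmul ω f _ _ hΩ _ hF =>
    rw [contr_tmul]
    refine add_mem ?_ ?_
    · cases ω with
      | zero =>
        rw [altInterior_eq_zero_of_mem X.1 hΩ, TensorProduct.zero_tmul, map_zero]
        exact zero_mem _
      | succ ω => exact tmul_mem_degree (by omega) (altInterior_mem X.1 hΩ) hF
    · cases f with
      | zero =>
        rw [symDeriv_eq_zero_of_mem X.2 hF, map_zero, TensorProduct.tmul_zero, map_zero]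
        exact zero_mem _
      | succ f =>
        rw [altSign_of_mem hΩ]
        exact tmul_mem_degree (by omega) (Submodule.smul_mem _ _ hΩ)
          (symSign_mem (symDeriv_mem X.2 hF))

theorem contr_eq_zero_of_mem (X : V₀ × V₁) {A : SuperExt V₀ V₁} (hA : A ∈ degree V₀ V₁ 0) :
    contr V₀ V₁ X A = 0 := by
  induction hA using degree_induction with
  | add A A' _ _ h h' => rw [map_add, h, h', add_zero]
  | tmul ω f _ _ hΩ _ hF =>
    obtain ⟨rfl, rfl⟩ : ω = 0 ∧ f = 0 := by omega
    rw [contr_tmul, altInterior_eq_zero_of_mem X.1 hΩ, symDeriv_eq_zero_of_mem X.2 hF, map_zero,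
      TensorProduct.zero_tmul, TensorProduct.tmul_zero, map_zero, add_zero]

theorem scalarPart_tmul (Ω : Alt V₀) (F : Sym V₁) :
    scalarPart V₀ V₁ (ofTensor V₀ V₁ (Ω ⊗ₜ[ℂ] F)) =
      ExteriorAlgebra.algebraMapInv (M := Module.Dual ℂ V₀) Ω *
        SymmetricAlgebra.algebraMapInv (M := Module.Dual ℂ V₁) F := rfl

theorem eq_scalarPart_smul_one {A : SuperExt V₀ V₁} (hA : A ∈ degree V₀ V₁ 0) :
    A = scalarPart V₀ V₁ A • 1 := by
  induction hA using degree_induction with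
  | add A A' _ _ h h' => rw [map_add, add_smul, ← h, ← h']
  | tmul ω f _ _ hΩ _ hF =>
    obtain ⟨rfl, rfl⟩ : ω = 0 ∧ f = 0 := by omega
    obtain ⟨r, rfl⟩ := Submodule.mem_one.mp (by simpa only [pow_zero] using hΩ)
    obtain ⟨s, rfl⟩ := Submodule.mem_one.mp (by simpa only [symPow, pow_zero] using hF)
    rw [scalarPart_tmul, ExteriorAlgebra.algebraMap_leftInverse,
      SymmetricAlgebra.algebraMap_leftInverse, Algebra.algebraMap_eq_smul_one,
      Algebra.algebraMap_eq_smul_one, TensorProduct.tmul_smul, ← TensorProduct.smul_tmul',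
      map_smul, map_smul, smul_smul, mul_comm]
    rfl

theorem sum_ι_mul_contr {κ₀ κ₁ : Type*} [Fintype κ₀] [Fintype κ₁] (e₀ : Module.Basis κ₀ ℂ V₀)
    (e₁ : Module.Basis κ₁ ℂ V₁) {n : ℕ} {A : SuperExt V₀ V₁} (hA : A ∈ degree V₀ V₁ n) :
    ∑ j, mapTensor V₀ V₁ (LinearMap.mulLeft ℂ (ExteriorAlgebra.ι ℂ (e₀.coord j))) LinearMap.id
        (contr V₀ V₁ (e₀ j, 0) A) +
      ∑ j, mapTensor V₀ V₁ (altSign V₀)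
        (LinearMap.mulLeft ℂ (SymmetricAlgebra.ι ℂ _ (e₁.coord j)) ∘ₗ symSign V₁)
        (contr V₀ V₁ (0, e₁ j) A) = (n : ℂ) • A := by
  induction hA using degree_induction with
  | add A A' _ _ h h' =>
    rw [smul_add, ← h, ← h']
    simp only [map_add, Finset.sum_add_distrib]
    abel
  | tmul _ _ hn _ hΩ _ hF =>
    simp only [contr_even_tmul, contr_odd_tmul, mapTensor_tmul, altSign_altSign,
      LinearMap.comp_apply, symSign_symSign, LinearMap.mulLeft_apply, LinearMap.id_apply]
    rw [← map_sum, ← map_sum, ← TensorProduct.sum_tmul, ← TensorProduct.tmul_sum,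
      sum_ι_mul_altInterior e₀ hΩ, sum_ι_mul_symDeriv e₁ hF, TensorProduct.tmul_smul,
      ← TensorProduct.smul_tmul', map_smul, map_smul, ← add_smul, ← hn, Nat.cast_add]

theorem eq_zero_of_contr_eq_zero [FiniteDimensional ℂ V₀] [FiniteDimensional ℂ V₁] {n : ℕ}
    {A : SuperExt V₀ V₁} (hA : A ∈ degree V₀ V₁ (n + 1))
    (h : ∀ x, ∀ X ∈ part V₀ V₁ x, contr V₀ V₁ X A = 0) : A = 0 := by
  have euler := sum_ι_mul_contr (Module.finBasis ℂ V₀) (Module.finBasis ℂ V₁) hA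
  simp only [h 0 _ (even_mem_part _), h 1 _ (odd_mem_part _), map_zero, Finset.sum_const_zero,
    add_zero] at euler
  exact (smul_eq_zero.mp euler.symm).resolve_left (Nat.cast_ne_zero.mpr n.succ_ne_zero)

theorem eval_succ {n : ℕ} (v : Fin (n + 1) → V₀ × V₁) (A : SuperExt V₀ V₁) :
    eval (n + 1) v A = eval n (Fin.tail v) (contr V₀ V₁ (v 0) A) := rfl

theorem eq_zero_of_eval_eq_zero [FiniteDimensional ℂ V₀] [FiniteDimensional ℂ V₁] {n : ℕ}
    {A : SuperExt V₀ V₁} (hA : A ∈ degree V₀ V₁ n)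
    (h : ∀ v : Fin n → V₀ × V₁, (∀ i, ∃ x, v i ∈ part V₀ V₁ x) → eval n v A = 0) : A = 0 := by
  induction n generalizing A with
  | zero =>
    have scalarPart_eq_zero : scalarPart V₀ V₁ A = 0 := h ![] (fun i => i.elim0)
    rw [eq_scalarPart_smul_one hA, scalarPart_eq_zero, zero_smul]
  | succ n ih =>
    refine eq_zero_of_contr_eq_zero hA fun x X hX => ih (contr_mem X hA) fun v hv => ?_
    have eval_cons := h (Fin.cons X v) (Fin.cases ⟨x, hX⟩ hv)
    rwa [eval_succ, Fin.cons_zero, Fin.tail_cons] at eval_cons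

theorem bidegree_three_zero :
    bidegree V₀ V₁ 3 0 = tensorPart V₀ V₁ 3 0 ⊔ tensorPart V₀ V₁ 1 2 := by
  refine le_antisymm (iSup_le fun ω => iSup_le fun f => iSup_le fun ⟨hn, hf⟩ => ?_)
    (sup_le (tensorPart_le_bidegree rfl rfl) (tensorPart_le_bidegree rfl rfl))
  have f_mod_two : f % 2 = 0 := Nat.mod_eq_zero_of_dvd ((ZMod.natCast_eq_zero_iff f 2).mp hf)
  obtain ⟨rfl, rfl⟩ | ⟨rfl, rfl⟩ : (ω = 3 ∧ f = 0) ∨ (ω = 1 ∧ f = 2) := by omega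
  · exact le_sup_left
  · exact le_sup_right

theorem disjoint_tensorPart {ω ω' : ℕ} (h : ω ≠ ω') (f f' : ℕ) :
    Disjoint (tensorPart V₀ V₁ ω f) (tensorPart V₀ V₁ ω' f') := by
  let projAlt : SuperExt V₀ V₁ →ₗ[ℂ] SuperExt V₀ V₁ :=
    mapTensor V₀ V₁ (GradedAlgebra.proj (fun i : ℕ => altPow V₀ i) ω) LinearMap.id
  have projAlt_eq_self : tensorPart V₀ V₁ ω f ≤ LinearMap.eqLocus projAlt LinearMap.id := by
    refine tensorPart_le fun Ω hΩ F _ => ?_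
    rw [LinearMap.mem_eqLocus, mapTensor_tmul, GradedAlgebra.proj_apply,
      DirectSum.decompose_of_mem_same _ hΩ]
    rfl
  have projAlt_eq_zero : tensorPart V₀ V₁ ω' f' ≤ LinearMap.ker projAlt := by
    refine tensorPart_le fun Ω hΩ F _ => ?_
    rw [LinearMap.mem_ker, mapTensor_tmul, GradedAlgebra.proj_apply,
      DirectSum.decompose_of_mem_ne _ hΩ h.symm, TensorProduct.zero_tmul, map_zero]
  rw [Submodule.disjoint_def]
  exact fun A hA hA' => (projAlt_eq_self hA).symm.trans (projAlt_eq_zero hA')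

end Degrees

section TrilinearForms

variable {V₀ V₁ : Type*} [AddCommGroup V₀] [Module ℂ V₀] [AddCommGroup V₁] [Module ℂ V₁]

variable (V₀ V₁) in
/-- The trilinear form of an element of `E(g)`, that is, `eval 3` in curried form. -/
def form : SuperExt V₀ V₁ →ₗ[ℂ] V₀ × V₁ →ₗ[ℂ] V₀ × V₁ →ₗ[ℂ] V₀ × V₁ →ₗ[ℂ] ℂ :=
  (contr V₀ V₁).flip.compr₂ ((contr V₀ V₁).flip.compr₂
    ((contr V₀ V₁).flip.compr₂ (scalarPart V₀ V₁)))

/-- The parity automorphism `X ↦ (-1)^x X` of `g`. -/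
def parityMap : V₀ × V₁ →ₗ[ℂ] V₀ × V₁ :=
  LinearMap.prodMap LinearMap.id (-LinearMap.id)

theorem form_apply (A : SuperExt V₀ V₁) (X Y Z : V₀ × V₁) :
    form V₀ V₁ A X Y Z =
      scalarPart V₀ V₁ (contr V₀ V₁ Z (contr V₀ V₁ Y (contr V₀ V₁ X A))) := rfl

theorem eval_three (A : SuperExt V₀ V₁) (X Y Z : V₀ × V₁) :
    eval 3 ![X, Y, Z] A = form V₀ V₁ A X Y Z := rfl

theorem form_swap_left (A : SuperExt V₀ V₁) {x y : ZMod 2} {X Y : V₀ × V₁}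
    (hX : X ∈ part V₀ V₁ x) (hY : Y ∈ part V₀ V₁ y) (Z : V₀ × V₁) :
    form V₀ V₁ A X Y Z = -sgn x y * form V₀ V₁ A Y X Z := by
  rw [form_apply, contr_supercomm hY hX, map_smul, map_smul, smul_eq_mul, sgn_comm y x, form_apply]

theorem form_swap_right (A : SuperExt V₀ V₁) {y z : ZMod 2} (X : V₀ × V₁) {Y Z : V₀ × V₁}
    (hY : Y ∈ part V₀ V₁ y) (hZ : Z ∈ part V₀ V₁ z) :
    form V₀ V₁ A X Y Z = -sgn y z * form V₀ V₁ A X Z Y := by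
  rw [form_apply, contr_supercomm hZ hY, map_smul, smul_eq_mul, sgn_comm z y, form_apply]

theorem scalarPart_parityTwist (x : ZMod 2) (A : SuperExt V₀ V₁) :
    scalarPart V₀ V₁ (parityTwist x A) = scalarPart V₀ V₁ A := by
  obtain rfl | rfl := zmod_two_cases x
  · rw [parityTwist_zero]
  have algebraMapInv_symSign (F : Sym V₁) :
      SymmetricAlgebra.algebraMapInv (R := ℂ) (M := Module.Dual ℂ V₁) (symSign V₁ F) =
        SymmetricAlgebra.algebraMapInv F := by
    suffices (SymmetricAlgebra.algebraMapInv (R := ℂ) (M := Module.Dual ℂ V₁)).comp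
        (SymmetricAlgebra.lift (-SymmetricAlgebra.ι ℂ _)) = SymmetricAlgebra.algebraMapInv from
      AlgHom.congr_fun this F
    exact SymmetricAlgebra.algHom_ext (by ext; simp [SymmetricAlgebra.algebraMapInv])
  induction A using superExt_induction with
  | tmul _ _ _ _ _ _ =>
    rw [parityTwist_one, paritySign_tmul, scalarPart_tmul, scalarPart_tmul, algebraMapInv_symSign]
  | add A A' h h' => simp only [map_add, h, h']

theorem form_eq_zero {n : ℕ} {b : ZMod 2} {A : SuperExt V₀ V₁} (hA : A ∈ bidegree V₀ V₁ n b)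
    {x y z : ZMod 2} {X Y Z : V₀ × V₁} (hX : X ∈ part V₀ V₁ x) (hY : Y ∈ part V₀ V₁ y)
    (hZ : Z ∈ part V₀ V₁ z) (h : x + y + z = b + 1) : form V₀ V₁ A X Y Z = 0 := by
  have move_sign :
      sgn 1 b * form V₀ V₁ A X Y Z = sgn 1 (x + y + z) * form V₀ V₁ A X Y Z := by
    simp only [form_apply]
    rw [← smul_eq_mul, ← map_smul, ← map_smul, ← map_smul, ← map_smul, ← parityTwist_of_mem 1 hA,
      contr_parityTwist 1 hX, map_smul, map_smul, map_smul,
      contr_parityTwist 1 hY, map_smul, map_smul, contr_parityTwist 1 hZ]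
    simp only [map_smul, scalarPart_parityTwist, sgn_add_right, smul_eq_mul]
    ring
  rw [h, sgn_add_right, sgn_one_one] at move_sign
  linear_combination (sgn 1 b / 2) * move_sign - form V₀ V₁ A X Y Z * sgn_mul_self 1 b

theorem parityMap_parityMap (X : V₀ × V₁) : parityMap (parityMap X) = X := by
  simp [parityMap]

theorem parityMap_of_mem {x : ZMod 2} {X : V₀ × V₁} (hX : X ∈ part V₀ V₁ x) :
    parityMap X = sgn x x • X := by
  obtain ⟨rfl, X, rfl⟩ | ⟨rfl, X, rfl⟩ := mem_part_cases hX
  · simp [parityMap, sgn_zero_left]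
  · simp [parityMap, sgn_one_one]

theorem form_cyclic {n : ℕ} {A : SuperExt V₀ V₁} (hA : A ∈ bidegree V₀ V₁ n 0)
    (X Y Z : V₀ × V₁) : form V₀ V₁ A (parityMap Z) X Y = form V₀ V₁ A X Y Z := by
  have cyclic : form V₀ V₁ A ∘ₗ parityMap = (LinearMap.lflip.comp (form V₀ V₁ A)).flip := by
    refine linearMap_ext_part fun z Z hZ => linearMap_ext_part fun x X hX =>
      linearMap_ext_part fun y Y hY => ?_
    change form V₀ V₁ A (parityMap Z) X Y = form V₀ V₁ A X Y Z
    rw [parityMap_of_mem hZ, map_smul, LinearMap.smul_apply, LinearMap.smul_apply, smul_eq_mul]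
    obtain h | h := zmod_two_cases (x + y + z)
    · have hz : z = x + y := by grind
      have sgn_self : sgn z z = sgn z x * sgn z y := by rw [← sgn_add_right, ← hz]
      rw [form_swap_left A hZ hX, form_swap_right A X hZ hY, sgn_self]
      linear_combination form V₀ V₁ A X Y Z *
        (sgn z y * sgn z y * sgn_mul_self z x + sgn_mul_self z y)
    · rw [form_eq_zero hA hX hY hZ h, form_eq_zero hA hZ hX hY (by rw [← h]; ring), mul_zero]
  exact congr($cyclic Z X Y)

end TrilinearForms

section QuadraticSpace

variable {V₀ V₁ : Type*} [AddCommGroup V₀] [Module ℂ V₀] [AddCommGroup V₁] [Module ℂ V₁]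
variable {B : LinearMap.BilinForm ℂ (V₀ × V₁)}

theorem IsQuadraticSpace.even_odd (hB : IsQuadraticSpace B) (X : V₀) (Y : V₁) :
    B (X, 0) (0, Y) = 0 :=
  hB.even _ (even_mem_part X) _ (odd_mem_part Y)

theorem IsQuadraticSpace.odd_even (hB : IsQuadraticSpace B) (X : V₀) (Y : V₁) :
    B (0, Y) (X, 0) = 0 := by
  rw [hB.supersymm 1 0 _ (odd_mem_part Y) _ (even_mem_part X), hB.even_odd, mul_zero]

theorem IsQuadraticSpace.even_symm (hB : IsQuadraticSpace B) (X X' : V₀) :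
    B (X, 0) (X', 0) = B (X', 0) (X, 0) := by
  rw [hB.supersymm 0 0 _ (even_mem_part X) _ (even_mem_part X'), sgn_zero_left, one_mul]

theorem IsQuadraticSpace.odd_antisymm (hB : IsQuadraticSpace B) (Y Y' : V₁) :
    B (0, Y) (0, Y') = -B (0, Y') (0, Y) := by
  rw [hB.supersymm 1 1 _ (odd_mem_part Y) _ (odd_mem_part Y'), sgn_one_one, neg_one_mul]

theorem IsQuadraticSpace.apply_parityMap (hB : IsQuadraticSpace B) (U W : V₀ × V₁) :
    B U (parityMap W) = B W U := by
  suffices B.compl₂ parityMap = B.flip from congr($this U W)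
  refine linearMap_ext_part fun u U hU => linearMap_ext_part fun w W hW => ?_
  change B U (parityMap W) = B W U
  obtain ⟨rfl, U, rfl⟩ | ⟨rfl, U, rfl⟩ := mem_part_cases hU <;>
  obtain ⟨rfl, W, rfl⟩ | ⟨rfl, W, rfl⟩ := mem_part_cases hW <;>
  rw [parityMap_of_mem hW, map_smul]
  · rw [sgn_zero_left, one_smul, hB.even_symm]
  · rw [hB.even_odd, smul_zero, hB.odd_even]
  · rw [hB.odd_even, smul_zero, hB.even_odd]
  · rw [sgn_one_one, neg_one_smul, ← hB.odd_antisymm]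

theorem IsQuadraticSpace.mem_part_of_apply_eq_zero (hB : IsQuadraticSpace B) {x : ZMod 2}
    {U : V₀ × V₁} (h : ∀ W ∈ part V₀ V₁ (x + 1), B U W = 0) : U ∈ part V₀ V₁ x := by
  have split (U : V₀ × V₁) : U = (U.1, 0) + (0, U.2) := by simp
  obtain rfl | rfl := zmod_two_cases x
  · have odd_part : ((0, U.2) : V₀ × V₁) = 0 := hB.nondegenerate.1 _ fun W => by
      have apply_odd := h (0, W.2) (odd_mem_part _)
      rw [split U, map_add, LinearMap.add_apply, hB.even_odd, zero_add] at apply_odd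
      rw [split W, map_add, hB.odd_even, zero_add, apply_odd]
    rw [split U, odd_part, add_zero]
    exact even_mem_part _
  · have even_part : ((U.1, 0) : V₀ × V₁) = 0 := hB.nondegenerate.1 _ fun W => by
      have apply_even := h (W.1, 0) (even_mem_part _)
      rw [split U, map_add, LinearMap.add_apply, hB.odd_even, add_zero] at apply_even
      rw [split W, map_add, hB.even_odd, add_zero, apply_even]
    rw [split U, even_part, zero_add]
    exact odd_mem_part _

end QuadraticSpace

section Poisson

variable {V₀ V₁ : Type*} [AddCommGroup V₀] [Module ℂ V₀] [AddCommGroup V₁] [Module ℂ V₁]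
variable {B : LinearMap.BilinForm ℂ (V₀ × V₁)} (b : AdaptedBasis B)

namespace AdaptedBasis

/-- The index set of the basis of `g` formed by the `Z_j`, the `X_i` and the `Y_i`. -/
abbrev Index : Type := Fin b.m ⊕ (Fin b.n ⊕ Fin b.n)

/-- The parity of the basis vector with a given index. -/
def parity : b.Index → ZMod 2 := Sum.elim (fun _ => 0) fun _ => 1

/-- The homogeneous basis of `g` formed by the `Z_j`, the `X_i` and the `Y_i`. -/
def basis : Module.Basis b.Index ℂ (V₀ × V₁) := b.even.prod b.odd

/-- The basis of `g` that is `B`-dual to `b.basis`: it consists of the `Z_j`, the `Y_i` and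
the `-X_i`. -/
def dual : b.Index → V₀ × V₁ :=
  Sum.elim (fun j => (b.even j, 0))
    (Sum.elim (fun i => (0, b.odd (.inr i))) fun i => -(0, b.odd (.inl i)))

theorem basis_mem_part (k : b.Index) : b.basis k ∈ part V₀ V₁ (b.parity k) := by
  rcases k with j | i
  · simpa [basis, parity] using even_mem_part (b.even j)
  · simpa [basis, parity] using odd_mem_part (b.odd i)

theorem dual_mem_part (k : b.Index) : b.dual k ∈ part V₀ V₁ (b.parity k) := by
  rcases k with j | i | i
  · exact even_mem_part _
  · exact odd_mem_part _
  · exact neg_mem (odd_mem_part _)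

theorem apply_basis_dual (hB : IsQuadraticSpace B) (k l : b.Index) :
    B (b.basis k) (b.dual l) = if k = l then 1 else 0 := by
  have pairing_inr (i j) :
      B (0, b.odd (.inr i)) (0, b.odd (.inl j)) = -if i = j then 1 else 0 := by
    rw [hB.odd_antisymm, b.darboux]
    simp only [eq_comm]
  rcases k with j | i | i <;> rcases l with j' | i' | i' <;>
    simp [-Prod.neg_mk, basis, dual, b.orthonormal, b.darboux, b.darboux_inl, b.darboux_inr,
      pairing_inr, hB.even_odd, hB.odd_even]

theorem sum_apply_dual_smul_basis (hB : IsQuadraticSpace B) (U : V₀ × V₁) :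
    ∑ k, B U (b.dual k) • b.basis k = U := by
  suffices ∑ k, (B.flip (b.dual k)).smulRight (b.basis k) = LinearMap.id by
    simpa only [LinearMap.sum_apply, LinearMap.smulRight_apply, LinearMap.BilinForm.flip_apply,
      LinearMap.id_apply] using congr($this U)
  refine b.basis.ext fun l => ?_
  simp only [LinearMap.sum_apply, LinearMap.smulRight_apply, LinearMap.BilinForm.flip_apply,
    b.apply_basis_dual hB, ite_smul, one_smul, zero_smul, Finset.sum_ite_eq, Finset.mem_univ,
    if_true, LinearMap.id_apply]

end AdaptedBasis

theorem twisted_tmul_of_mem (m : Alt V₀ →ₗ[ℂ] Alt V₀ →ₗ[ℂ] Alt V₀)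
    (m' : Sym V₁ →ₗ[ℂ] Sym V₁ →ₗ[ℂ] Sym V₁) {f : ℕ} (Ω : Alt V₀) {F : Sym V₁}
    (hF : F ∈ symPow V₁ f) (Ω' : Alt V₀) (F' : Sym V₁) :
    twisted V₀ V₁ m m' (ofTensor V₀ V₁ (Ω ⊗ₜ[ℂ] F)) (ofTensor V₀ V₁ (Ω' ⊗ₜ[ℂ] F')) =
      ofTensor V₀ V₁ (m Ω ((altSign V₀ ^ f) Ω') ⊗ₜ[ℂ] m' F F') := by
  induction Ω' using DirectSum.Decomposition.inductionOn (fun i : ℕ => altPow V₀ i) with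
  | zero => simp only [TensorProduct.zero_tmul, map_zero]
  | add Ω₁ Ω₂ h₁ h₂ => simp only [TensorProduct.add_tmul, map_add, h₁, h₂]
  | homogeneous Ω' =>
    rw [twisted_tmul V₀ V₁ m m' Ω hF Ω'.2, altSign_pow_of_mem f Ω'.2, map_smul,
      ← TensorProduct.smul_tmul', map_smul]

theorem contr_even_tmul_mul_contr_even_tmul (X Y : V₀) {f : ℕ} (Ω : Alt V₀) {F : Sym V₁}
    (hF : F ∈ symPow V₁ f) (Ω' : Alt V₀) (F' : Sym V₁) :
    contr V₀ V₁ (X, 0) (totalSign (ofTensor V₀ V₁ (Ω ⊗ₜ[ℂ] F))) *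
        contr V₀ V₁ (Y, 0) (ofTensor V₀ V₁ (Ω' ⊗ₜ[ℂ] F')) =
      ofTensor V₀ V₁ ((altInterior X (altSign V₀ Ω) *
        altInterior Y ((altSign V₀ ^ f) Ω')) ⊗ₜ[ℂ] (F * F')) := by
  rw [totalSign_tmul, contr_even_tmul, contr_even_tmul, tmul_mul_tmul _ (symSign_mem hF),
    symSign_of_mem hF, altInterior_altSign_pow, mul_smul_comm, smul_mul_assoc,
    TensorProduct.smul_tmul]

theorem contr_odd_tmul_mul_contr_odd_tmul (X Y : V₁) {f : ℕ} (Ω : Alt V₀) {F : Sym V₁}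
    (hF : F ∈ symPow V₁ f) (Ω' : Alt V₀) (F' : Sym V₁) :
    contr V₀ V₁ (0, X) (totalSign (ofTensor V₀ V₁ (Ω ⊗ₜ[ℂ] F))) *
        paritySign V₀ V₁ (contr V₀ V₁ (0, Y) (ofTensor V₀ V₁ (Ω' ⊗ₜ[ℂ] F'))) =
      -ofTensor V₀ V₁ ((Ω * (altSign V₀ ^ f) Ω') ⊗ₜ[ℂ] (symDeriv X F * symDeriv Y F')) := by
  rw [totalSign_tmul, contr_odd_tmul Y, paritySign_tmul,
    contr_odd_tmul_mul_tmul X _ (symSign_mem hF)]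
  simp only [altSign_mul, altSign_pow_altSign, altSign_altSign, symDeriv_symSign, map_neg,
    symSign_symSign, neg_mul, TensorProduct.tmul_neg]

theorem poisson_eq_sum (A A' : SuperExt V₀ V₁) :
    poisson b A A' = -∑ k, contr V₀ V₁ (b.basis k) (totalSign A) *
      parityTwist (b.parity k) (contr V₀ V₁ (b.dual k) A') := by
  induction A using superExt_induction with
  | add A₁ A₂ h₁ h₂ =>
    simp only [map_add, LinearMap.add_apply, add_mul, Finset.sum_add_distrib, neg_add, h₁, h₂]
  | tmul _ _ _ _ _ hF =>
    induction A' using superExt_induction with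
    | add A₁ A₂ h₁ h₂ => simp only [map_add, mul_add, Finset.sum_add_distrib, neg_add, h₁, h₂]
    | tmul _ _ _ _ _ _ =>
      rw [poisson, LinearMap.add_apply, LinearMap.add_apply, twisted_tmul_of_mem _ _ _ hF,
        twisted_tmul_of_mem _ _ _ hF]
      simp only [Fintype.sum_sum_type, AdaptedBasis.basis, AdaptedBasis.dual, AdaptedBasis.parity,
        Module.Basis.prod_apply, Sum.elim_inl, Sum.elim_inr, Function.comp_apply,
        LinearMap.inl_apply, LinearMap.inr_apply, parityTwist_zero, parityTwist_one, map_neg,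
        LinearMap.neg_apply, mul_neg, contr_even_tmul_mul_contr_even_tmul _ _ _ hF,
        contr_odd_tmul_mul_contr_odd_tmul _ _ _ hF, altPoisson, symPoisson, LinearMap.sum_apply,
        LinearMap.sub_apply, LinearMap.compl₁₂_apply, LinearMap.mul_apply', LinearMap.comp_apply,
        Derivation.coeFn_coe, TensorProduct.neg_tmul, TensorProduct.sum_tmul,
        TensorProduct.tmul_sum, TensorProduct.tmul_sub, map_sum, map_sub, neg_add,
        Finset.sum_neg_distrib, Finset.sum_sub_distrib, neg_neg]
      rw [sub_eq_add_neg]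

theorem contr_contr_mul_contr {x z : ZMod 2} {X Y Z : V₀ × V₁} (hX : X ∈ part V₀ V₁ x)
    (hY : Y ∈ part V₀ V₁ x) (hZ : Z ∈ part V₀ V₁ z) (A A' : SuperExt V₀ V₁) :
    contr V₀ V₁ Z (contr V₀ V₁ X (totalSign A) * parityTwist x (contr V₀ V₁ Y A')) =
      contr V₀ V₁ X (totalSign (contr V₀ V₁ Z A)) *
          parityTwist x (contr V₀ V₁ Y (parityTwist z A')) +
        contr V₀ V₁ X (totalSign (totalSign A)) *
          parityTwist x (contr V₀ V₁ Y (contr V₀ V₁ Z A')) := by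
  rw [contr_mul hZ]
  congr 1
  · rw [contr_supercomm hZ hX, contr_totalSign Z, map_neg, neg_smul, smul_neg, neg_neg,
      contr_parityTwist z hY, map_smul, parityTwist_comm z, smul_mul_assoc, mul_smul_comm,
      sgn_comm]
  · rw [contr_totalSign X (totalSign A), contr_parityTwist x hZ, contr_supercomm hZ hY, map_smul,
      smul_smul, neg_mul, mul_smul_comm, sgn_comm z x, mul_neg, sgn_mul_self, neg_one_smul]

theorem contr_poisson {z : ZMod 2} {Z : V₀ × V₁} (hZ : Z ∈ part V₀ V₁ z)
    (A A' : SuperExt V₀ V₁) :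
    contr V₀ V₁ Z (poisson b A A') = poisson b (contr V₀ V₁ Z A) (parityTwist z A') +
      poisson b (totalSign A) (contr V₀ V₁ Z A') := by
  simp only [poisson_eq_sum, map_neg, map_sum,
    contr_contr_mul_contr (b.basis_mem_part _) (b.dual_mem_part _) hZ, Finset.sum_add_distrib,
    neg_add]

theorem mul_mem_degree {n m : ℕ} {A A' : SuperExt V₀ V₁} (hA : A ∈ degree V₀ V₁ n)
    (hA' : A' ∈ degree V₀ V₁ m) : A * A' ∈ degree V₀ V₁ (n + m) := by
  induction hA using degree_induction with
  | add A₁ A₂ _ _ h₁ h₂ => rw [add_mul]; exact add_mem h₁ h₂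
  | tmul _ f _ _ hΩ _ hF =>
    induction hA' using degree_induction with
    | add A₁ A₂ _ _ h₁ h₂ => rw [mul_add]; exact add_mem h₁ h₂
    | tmul _ _ _ _ hΩ' _ hF' =>
      rw [tmul_mul_tmul _ hF, altSign_pow_of_mem f hΩ']
      exact tmul_mem_degree (by omega)
        (SetLike.mul_mem_graded hΩ (Submodule.smul_mem _ _ hΩ')) (SetLike.mul_mem_graded hF hF')

theorem parityTwist_mem (x : ZMod 2) {n : ℕ} {A : SuperExt V₀ V₁} (hA : A ∈ degree V₀ V₁ n) :
    parityTwist x A ∈ degree V₀ V₁ n := by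
  obtain rfl | rfl := zmod_two_cases x
  · exact hA
  induction hA using degree_induction with
  | add A A' _ _ h h' => rw [map_add]; exact add_mem h h'
  | tmul _ _ hn _ hΩ _ hF =>
    rw [parityTwist_one, paritySign_tmul]
    exact tmul_mem_degree hn hΩ (symSign_mem hF)

theorem poisson_mem {n m : ℕ} {A A' : SuperExt V₀ V₁} (hA : A ∈ degree V₀ V₁ (n + 1))
    (hA' : A' ∈ degree V₀ V₁ (m + 1)) : poisson b A A' ∈ degree V₀ V₁ (n + m) := by
  rw [poisson_eq_sum]
  refine neg_mem (sum_mem fun k _ => mul_mem_degree (contr_mem _ ?_)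
    (parityTwist_mem _ (contr_mem _ hA')))
  rw [totalSign_of_mem hA]
  exact Submodule.smul_mem _ _ hA

theorem poisson_eq_zero_of_mem_left {A : SuperExt V₀ V₁} (hA : A ∈ degree V₀ V₁ 0)
    (A' : SuperExt V₀ V₁) : poisson b A A' = 0 := by
  simp only [poisson_eq_sum, totalSign_of_mem hA, map_smul, contr_eq_zero_of_mem _ hA, smul_zero,
    zero_mul, Finset.sum_const_zero, neg_zero]

theorem poisson_eq_zero_of_mem_right (A : SuperExt V₀ V₁) {A' : SuperExt V₀ V₁}
    (hA' : A' ∈ degree V₀ V₁ 0) : poisson b A A' = 0 := by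
  simp only [poisson_eq_sum, contr_eq_zero_of_mem _ hA', map_zero, mul_zero,
    Finset.sum_const_zero, neg_zero]

theorem poisson_of_mem_one (hB : IsQuadraticSpace B) {α β : SuperExt V₀ V₁}
    (hα : α ∈ degree V₀ V₁ 1) (hβ : β ∈ degree V₀ V₁ 1) {U V : V₀ × V₁}
    (hU : ∀ W, scalarPart V₀ V₁ (contr V₀ V₁ W α) = B U W)
    (hV : ∀ W, scalarPart V₀ V₁ (contr V₀ V₁ W β) = B V W) :
    poisson b α β = B U V • 1 := by
  have parityTwist_one_eq (x : ZMod 2) : parityTwist x (1 : SuperExt V₀ V₁) = 1 := by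
    obtain rfl | rfl := zmod_two_cases x
    · rfl
    · exact (paritySign_tmul 1 1).trans (by rw [symSign, AlgHom.toLinearMap_apply, map_one]; rfl)
  have contr_eq {γ : SuperExt V₀ V₁} {T : V₀ × V₁} (hγ : γ ∈ degree V₀ V₁ 1)
      (hT : ∀ W, scalarPart V₀ V₁ (contr V₀ V₁ W γ) = B T W) (W : V₀ × V₁) :
      contr V₀ V₁ W γ = B T W • 1 := by
    rw [eq_scalarPart_smul_one (contr_mem W hγ), hT]
  simp only [poisson_eq_sum, totalSign_of_mem hα, pow_one, neg_one_smul, map_neg, neg_mul,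
    Finset.sum_neg_distrib, neg_neg, contr_eq hα hU, contr_eq hβ hV, map_smul, parityTwist_one_eq,
    smul_mul_smul_comm, mul_one, ← Finset.sum_smul]
  conv_rhs => rw [← b.sum_apply_dual_smul_basis hB V]
  simp only [map_sum, map_smul, smul_eq_mul, mul_comm]

end Poisson

section TensorContraction

variable {R M M' N : Type*} [CommRing R] [AddCommGroup M] [Module R M] [AddCommGroup M']
  [Module R M'] [AddCommGroup N] [Module R N]

/-- The contraction `m ⊗ X ↦ φ(X) m` of the second factor of `M ⊗ N` with a linear form. -/
def tensorContr (φ : Module.Dual R N) : M ⊗[R] N →ₗ[R] M :=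
  (TensorProduct.rid R M).toLinearMap ∘ₗ LinearMap.lTensor M φ

theorem tensorContr_tmul (φ : Module.Dual R N) (m : M) (X : N) :
    tensorContr φ (m ⊗ₜ[R] X) = φ X • m := rfl

theorem tensorContr_rTensor (φ : Module.Dual R N) (g : M →ₗ[R] M') (t : M ⊗[R] N) :
    tensorContr φ (LinearMap.rTensor N g t) = g (tensorContr φ t) := by
  suffices tensorContr φ ∘ₗ LinearMap.rTensor N g = g ∘ₗ tensorContr φ from congr($this t)
  refine TensorProduct.ext' fun m X => ?_
  simp only [LinearMap.comp_apply, LinearMap.rTensor_tmul, tensorContr_tmul, map_smul]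

theorem eq_zero_of_tensorContr_eq_zero [Module.Free R N] {t : M ⊗[R] N}
    (h : ∀ φ : Module.Dual R N, tensorContr φ t = 0) : t = 0 := by
  let e := Module.Free.chooseBasis R N
  refine (TensorProduct.equivFinsuppOfBasisRight e).map_eq_zero_iff.mp (Finsupp.ext fun i => ?_)
  rw [TensorProduct.equivFinsuppOfBasisRight_apply]
  exact h (e.coord i)

end TensorContraction

section Differentials

variable {V₀ V₁ : Type*} [AddCommGroup V₀] [Module ℂ V₀] [AddCommGroup V₁] [Module ℂ V₁]

theorem superD_tmul (Ω : SuperExt V₀ V₁) (X : V₀ × V₁) (A : SuperExt V₀ V₁) :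
    superD (Ω ⊗ₜ[ℂ] X) A =
      -(Ω * evenInterior X.1 A + paritySign V₀ V₁ Ω * oddInterior X.2 A) := rfl

theorem superD_tmul_of_mem (Ω : SuperExt V₀ V₁) {x : ZMod 2} {X : V₀ × V₁}
    (hX : X ∈ part V₀ V₁ x) (A : SuperExt V₀ V₁) :
    superD (Ω ⊗ₜ[ℂ] X) A = -(parityTwist x Ω * contr V₀ V₁ X (parityTwist x A)) := by
  have evenInterior_zero (A : SuperExt V₀ V₁) : evenInterior (0 : V₀) A = 0 := by
    simpa only [zero_smul] using evenInterior_smul 0 (0 : V₀) A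
  have oddInterior_zero (A : SuperExt V₀ V₁) : oddInterior (0 : V₁) A = 0 := by
    simpa only [zero_smul] using oddInterior_smul 0 (0 : V₁) A
  obtain ⟨rfl, X, rfl⟩ | ⟨rfl, X, rfl⟩ := mem_part_cases hX
  · simp only [superD_tmul, contr, LinearMap.mk₂_apply, parityTwist_zero, oddInterior_zero,
      mul_zero, add_zero]
  · simp only [superD_tmul, contr, LinearMap.mk₂_apply, parityTwist_one, evenInterior_zero,
      mul_zero, zero_add, paritySign_paritySign]

theorem superD_ι_tmul_one (t : SuperExt V₀ V₁ ⊗[ℂ] (V₀ × V₁)) (α : Module.Dual ℂ V₀) :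
    superD t (ofTensor V₀ V₁ (ExteriorAlgebra.ι ℂ α ⊗ₜ[ℂ] 1)) =
      -tensorContr (α ∘ₗ LinearMap.fst ℂ V₀ V₁) t := by
  induction t with
  | zero => simp only [map_zero, LinearMap.zero_apply, neg_zero]
  | add s t hs ht => rw [map_add, map_add, LinearMap.add_apply, hs, ht, neg_add]
  | tmul _ X =>
    have even_ι : evenInterior X.1 (ofTensor V₀ V₁ (ExteriorAlgebra.ι ℂ α ⊗ₜ[ℂ] 1)) =
        α X.1 • 1 := by
      rw [evenInterior, mapTensor_tmul, altInterior_ι, Algebra.algebraMap_eq_smul_one,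
        ← TensorProduct.smul_tmul', map_smul]
      rfl
    have odd_ι : oddInterior X.2 (ofTensor V₀ V₁ (ExteriorAlgebra.ι ℂ α ⊗ₜ[ℂ] 1)) = 0 := by
      rw [oddInterior, mapTensor_tmul, LinearMap.neg_apply, Derivation.coeFn_coe,
        Derivation.map_one_eq_zero, neg_zero, TensorProduct.tmul_zero, map_zero]
    rw [superD_tmul, even_ι, odd_ι, mul_zero, add_zero, mul_smul_comm, mul_one, tensorContr_tmul]
    rfl

theorem superD_one_tmul_ι (t : SuperExt V₀ V₁ ⊗[ℂ] (V₀ × V₁)) (p : Module.Dual ℂ V₁) :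
    superD t (ofTensor V₀ V₁ (1 ⊗ₜ[ℂ] SymmetricAlgebra.ι ℂ _ p)) =
      paritySign V₀ V₁ (tensorContr (p ∘ₗ LinearMap.snd ℂ V₀ V₁) t) := by
  induction t with
  | zero => simp only [map_zero, LinearMap.zero_apply]
  | add s t hs ht => rw [map_add, map_add, LinearMap.add_apply, hs, ht, map_add]
  | tmul _ X =>
    have even_ι : evenInterior X.1 (ofTensor V₀ V₁ (1 ⊗ₜ[ℂ] SymmetricAlgebra.ι ℂ _ p)) = 0 := by
      rw [evenInterior, mapTensor_tmul, ← map_one (algebraMap ℂ (Alt V₀)), altInterior_algebraMap,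
        TensorProduct.zero_tmul, map_zero]
    have odd_ι : oddInterior X.2 (ofTensor V₀ V₁ (1 ⊗ₜ[ℂ] SymmetricAlgebra.ι ℂ _ p)) =
        -p X.2 • 1 := by
      rw [oddInterior, mapTensor_tmul, LinearMap.neg_apply, Derivation.coeFn_coe, symDeriv_ι,
        Algebra.algebraMap_eq_smul_one, ← neg_smul, ← map_one (algebraMap ℂ (Alt V₀)),
        altSign_algebraMap, map_one, TensorProduct.tmul_smul, map_smul]
      rfl
    rw [superD_tmul, even_ι, odd_ι, mul_zero, zero_add, mul_smul_comm, mul_one, neg_smul, neg_neg,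
      tensorContr_tmul, map_smul]
    rfl

theorem eval_tensorContr (φ : Module.Dual ℂ (V₀ × V₁)) (t : SuperExt V₀ V₁ ⊗[ℂ] (V₀ × V₁))
    (Y Z : V₀ × V₁) : eval 2 ![Y, Z] (tensorContr φ t) = φ (toBilin t Y Z) := by
  rw [← tensorContr_rTensor, toBilin]
  generalize LinearMap.rTensor (V₀ × V₁) (eval 2 ![Y, Z]) t = s
  suffices tensorContr φ = φ ∘ₗ (TensorProduct.lid ℂ (V₀ × V₁)).toLinearMap from congr($this s)
  refine TensorProduct.ext' fun c X => ?_
  rw [tensorContr_tmul, LinearMap.comp_apply, LinearEquiv.coe_coe, TensorProduct.lid_tmul, map_smul,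
    smul_eq_mul, smul_eq_mul, mul_comm]

theorem IsDifferential.sub {F G : V₀ × V₁ →ₗ[ℂ] V₀ × V₁ →ₗ[ℂ] V₀ × V₁}
    {d d' : SuperExt V₀ V₁ →ₗ[ℂ] SuperExt V₀ V₁} (h : IsDifferential F d)
    (h' : IsDifferential G d') : IsDifferential (F - G) (d - d') := by
  obtain ⟨t, ht, rfl⟩ := h
  obtain ⟨t', ht', rfl⟩ := h'
  refine ⟨t - t', fun Y Z => ?_, by rw [map_sub, map_sub]⟩
  rw [LinearMap.sub_apply, LinearMap.sub_apply, ← ht, ← ht']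
  simp only [toBilin, map_sub]

theorem IsDifferential.eq_zero_of_bracket_eq_zero [FiniteDimensional ℂ V₀] [FiniteDimensional ℂ V₁]
    {d : SuperExt V₀ V₁ →ₗ[ℂ] SuperExt V₀ V₁} (h : IsDifferential 0 d) : d = 0 := by
  obtain ⟨t, ht, rfl⟩ := h
  suffices t = 0 by rw [this, map_zero, map_zero]
  refine eq_zero_of_tensorContr_eq_zero fun φ => Subtype.ext ?_
  refine eq_zero_of_eval_eq_zero (Subtype.prop _) fun v _ => ?_
  rw [show v = ![v 0, v 1] from List.ofFn_injective rfl, ← Submodule.subtype_apply,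
    ← tensorContr_rTensor, eval_tensorContr, ht, LinearMap.zero_apply, LinearMap.zero_apply,
    map_zero]

theorem IsDifferential.bracket_eq_zero {F : V₀ × V₁ →ₗ[ℂ] V₀ × V₁ →ₗ[ℂ] V₀ × V₁}
    (h : IsDifferential F 0) : F = 0 := by
  obtain ⟨t, ht, hd⟩ := h
  refine LinearMap.ext₂ fun Y Z => Prod.ext ?_ ?_
  · refine (Module.forall_dual_apply_eq_zero_iff ℂ _).mp fun α => ?_
    change (α ∘ₗ LinearMap.fst ℂ V₀ V₁) (F Y Z) = 0
    rw [← ht, ← eval_tensorContr, ← neg_eq_zero, ← map_neg, ← superD_ι_tmul_one, hd,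
      LinearMap.zero_apply, map_zero]
  · refine (Module.forall_dual_apply_eq_zero_iff ℂ _).mp fun p => ?_
    change (p ∘ₗ LinearMap.snd ℂ V₀ V₁) (F Y Z) = 0
    rw [← ht, ← eval_tensorContr, ← paritySign_paritySign (tensorContr _ _), ← superD_one_tmul_ι,
      hd, LinearMap.zero_apply, map_zero, map_zero]

theorem IsDifferential.unique_operator [FiniteDimensional ℂ V₀] [FiniteDimensional ℂ V₁]
    {F : V₀ × V₁ →ₗ[ℂ] V₀ × V₁ →ₗ[ℂ] V₀ × V₁} {d d' : SuperExt V₀ V₁ →ₗ[ℂ] SuperExt V₀ V₁}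
    (h : IsDifferential F d) (h' : IsDifferential F d') : d = d' :=
  sub_eq_zero.mp (IsDifferential.eq_zero_of_bracket_eq_zero (sub_self F ▸ h.sub h'))

theorem IsDifferential.unique_bracket {F G : V₀ × V₁ →ₗ[ℂ] V₀ × V₁ →ₗ[ℂ] V₀ × V₁}
    {d : SuperExt V₀ V₁ →ₗ[ℂ] SuperExt V₀ V₁} (h : IsDifferential F d)
    (h' : IsDifferential G d) : F = G :=
  sub_eq_zero.mp (IsDifferential.bracket_eq_zero (sub_self d ▸ h.sub h'))

end Differentials

section Bracket

variable {V₀ V₁ : Type*} [AddCommGroup V₀] [Module ℂ V₀] [AddCommGroup V₁] [Module ℂ V₁]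
variable {B : LinearMap.BilinForm ℂ (V₀ × V₁)} {F : V₀ × V₁ →ₗ[ℂ] V₀ × V₁ →ₗ[ℂ] V₀ × V₁}
  {I : SuperExt V₀ V₁}

/-- The bilinear map `F` with `B(F(X, Y), Z) = I(X, Y, Z)`, for `I ∈ E^{(3,0)}(g)`. -/
def bracketOf (b : AdaptedBasis B) (I : SuperExt V₀ V₁) :
    V₀ × V₁ →ₗ[ℂ] V₀ × V₁ →ₗ[ℂ] V₀ × V₁ :=
  ∑ k, (form V₀ V₁ I (b.basis k)).compr₂ (LinearMap.toSpanSingleton ℂ _ (b.dual k))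

theorem bracketOf_apply (b : AdaptedBasis B) (I : SuperExt V₀ V₁) (X Y : V₀ × V₁) :
    bracketOf b I X Y = ∑ k, form V₀ V₁ I (b.basis k) X Y • b.dual k := by
  simp only [bracketOf, LinearMap.sum_apply, LinearMap.compr₂_apply,
    LinearMap.toSpanSingleton_apply]

theorem isAssociated_bracketOf (hB : IsQuadraticSpace B) (b : AdaptedBasis B)
    (hI : I ∈ bidegree V₀ V₁ 3 0) : IsAssociated B (bracketOf b I) I := by
  intro X Y Z
  have apply_dual (k) : B (parityMap Z) (b.dual k) = B (b.dual k) Z := by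
    rw [← hB.apply_parityMap, parityMap_parityMap]
  rw [eval_three, ← form_cyclic hI, ← b.sum_apply_dual_smul_basis hB (parityMap Z),
    bracketOf_apply]
  simp only [map_sum, map_smul, LinearMap.sum_apply, LinearMap.smul_apply, smul_eq_mul, apply_dual,
    mul_comm]

theorem isDifferential_bracketOf (b : AdaptedBasis B) (hI : I ∈ bidegree V₀ V₁ 3 0) :
    IsDifferential (bracketOf b I) (-poisson b I) := by
  have degree_I := bidegree_le_degree 3 0 hI
  refine ⟨∑ k, ⟨contr V₀ V₁ (b.basis k) I, contr_mem _ degree_I⟩ ⊗ₜ[ℂ] b.dual k,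
    fun Y Z => ?_, LinearMap.ext fun A => ?_⟩
  · simp only [toBilin, map_sum, LinearMap.rTensor_tmul, TensorProduct.lid_tmul, bracketOf_apply]
    rfl
  have parityTwist_I (x : ZMod 2) : parityTwist x I = I := by
    rw [parityTwist_of_mem x hI, sgn_zero_right, one_smul]
  have contr_twist {x : ZMod 2} {W : V₀ × V₁} (hW : W ∈ part V₀ V₁ x) :
      parityTwist x (contr V₀ V₁ W I) = sgn x x • contr V₀ V₁ W I := by
    conv_rhs => rw [← parityTwist_I x, contr_parityTwist x hW, smul_smul, sgn_mul_self, one_smul]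
  have twist_contr (k) (A : SuperExt V₀ V₁) :
      contr V₀ V₁ (b.dual k) (parityTwist (b.parity k) A) =
        sgn (b.parity k) (b.parity k) • parityTwist (b.parity k) (contr V₀ V₁ (b.dual k) A) :=
    contr_parityTwist _ (b.dual_mem_part k) A
  simp only [map_sum, LinearMap.rTensor_tmul, Submodule.subtype_apply, LinearMap.sum_apply,
    LinearMap.neg_apply, superD_tmul_of_mem _ (b.dual_mem_part _),
    contr_twist (b.basis_mem_part _), twist_contr, mul_smul_comm, smul_smul, sgn_mul_self,
    one_smul, poisson_eq_sum, totalSign_of_mem degree_I, map_smul, smul_mul_assoc]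
  rw [← Finset.smul_sum, Finset.sum_neg_distrib]
  module

theorem IsAssociated.bracket_unique (hB : IsQuadraticSpace B) (h : IsAssociated B F I)
    {G : V₀ × V₁ →ₗ[ℂ] V₀ × V₁ →ₗ[ℂ] V₀ × V₁} (h' : IsAssociated B G I) : F = G := by
  refine LinearMap.ext₂ fun X Y => sub_eq_zero.mp (hB.nondegenerate.1 _ fun Z => ?_)
  rw [map_sub, LinearMap.sub_apply, ← h, ← h', sub_self]

theorem IsAssociated.isDifferential (hB : IsQuadraticSpace B) (b : AdaptedBasis B)
    (hI : I ∈ bidegree V₀ V₁ 3 0) (h : IsAssociated B F I) : IsDifferential F (-poisson b I) :=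
  h.bracket_unique hB (isAssociated_bracketOf hB b hI) ▸ isDifferential_bracketOf b hI

theorem IsAssociated.isEvenSuperAntisymm (hB : IsQuadraticSpace B)
    (hI : I ∈ bidegree V₀ V₁ 3 0) (h : IsAssociated B F I) : IsEvenSuperAntisymm F where
  even x y X hX Y hY := hB.mem_part_of_apply_eq_zero fun Z hZ => by
    rw [← h, eval_three]
    exact form_eq_zero hI hX hY hZ (by grind)
  antisymm x y X hX Y hY := by
    refine sub_eq_zero.mp (hB.nondegenerate.1 _ fun Z => ?_)
    rw [map_sub, LinearMap.sub_apply, map_smul, LinearMap.smul_apply, ← h, ← h, eval_three,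
      eval_three, form_swap_left I hX hY, smul_eq_mul, sub_self]

theorem IsAssociated.isInvariant (hB : IsQuadraticSpace B) (hI : I ∈ bidegree V₀ V₁ 3 0)
    (h : IsAssociated B F I) : IsInvariant B F := by
  intro X Y Z
  rw [← hB.apply_parityMap _ X, ← h, ← h, eval_three, eval_three, ← form_cyclic hI Y Z,
    parityMap_parityMap]

end Bracket

section Jacobi

variable {V₀ V₁ : Type*} [AddCommGroup V₀] [Module ℂ V₀] [AddCommGroup V₁] [Module ℂ V₁]
variable {B : LinearMap.BilinForm ℂ (V₀ × V₁)} (b : AdaptedBasis B)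

/-- `A` is homogeneous of parity `u` for the `ℤ/2`-grading of `E(g)`. -/
def HasParity (u : ZMod 2) (A : SuperExt V₀ V₁) : Prop :=
  ∀ x, parityTwist x A = sgn x u • A

theorem HasParity.contr {u x : ZMod 2} {A : SuperExt V₀ V₁} (hA : HasParity u A) {X : V₀ × V₁}
    (hX : X ∈ part V₀ V₁ x) : HasParity (u + x) (contr V₀ V₁ X A) := fun y => by
  rw [sgn_add_right, mul_comm, mul_smul, ← map_smul, ← hA, contr_parityTwist y hX, smul_smul,
    sgn_mul_self, one_smul]

theorem contr_poisson_of_mem {x u : ZMod 2} {X : V₀ × V₁} (hX : X ∈ part V₀ V₁ x) {n : ℕ}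
    {A A' : SuperExt V₀ V₁} (hA : A ∈ degree V₀ V₁ n) (hA' : HasParity u A') :
    contr V₀ V₁ X (poisson b A A') = sgn x u • poisson b (contr V₀ V₁ X A) A' +
      (-1 : ℂ) ^ n • poisson b A (contr V₀ V₁ X A') := by
  rw [contr_poisson b hX, totalSign_of_mem hA, hA', map_smul, map_smul, LinearMap.smul_apply]

theorem contr_poisson_of_mem_one_left {x : ZMod 2} {X : V₀ × V₁} (hX : X ∈ part V₀ V₁ x)
    {α : SuperExt V₀ V₁} (hα : α ∈ degree V₀ V₁ 1) (A : SuperExt V₀ V₁) :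
    contr V₀ V₁ X (poisson b α A) = -poisson b α (contr V₀ V₁ X A) := by
  rw [contr_poisson b hX, poisson_eq_zero_of_mem_left b (contr_mem X hα), zero_add,
    totalSign_of_mem hα, pow_one, neg_one_smul, map_neg, LinearMap.neg_apply]

theorem contr_poisson_of_mem_one_right {x u : ZMod 2} {X : V₀ × V₁} (hX : X ∈ part V₀ V₁ x)
    (A : SuperExt V₀ V₁) {α : SuperExt V₀ V₁} (hα : α ∈ degree V₀ V₁ 1) (hu : HasParity u α) :
    contr V₀ V₁ X (poisson b A α) = sgn x u • poisson b (contr V₀ V₁ X A) α := by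
  rw [contr_poisson b hX, poisson_eq_zero_of_mem_right b _ (contr_mem X hα), add_zero, hu,
    map_smul]

theorem contr_contr_poisson_of_mem_two {z t u : ZMod 2} {Z T : V₀ × V₁}
    (hZ : Z ∈ part V₀ V₁ z) (hT : T ∈ part V₀ V₁ t) {A A' : SuperExt V₀ V₁}
    (hA : A ∈ degree V₀ V₁ 2) (hA' : A' ∈ degree V₀ V₁ 2) (hu : HasParity u A') :
    contr V₀ V₁ T (contr V₀ V₁ Z (poisson b A A')) =
      sgn t (u + z) • poisson b (contr V₀ V₁ T A) (contr V₀ V₁ Z A') -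
        sgn z u • poisson b (contr V₀ V₁ Z A) (contr V₀ V₁ T A') := by
  rw [contr_poisson_of_mem b hZ hA hu, map_add, map_smul, map_smul,
    contr_poisson_of_mem_one_left b hT (contr_mem Z hA),
    contr_poisson_of_mem_one_right b hT A (contr_mem Z hA') (hu.contr hZ), neg_one_sq, one_smul,
    smul_neg, neg_add_eq_sub]

theorem contr_contr_poisson_self {x y : ZMod 2} {X Y : V₀ × V₁} (hX : X ∈ part V₀ V₁ x)
    (hY : Y ∈ part V₀ V₁ y) {I : SuperExt V₀ V₁} (hI : I ∈ bidegree V₀ V₁ 3 0) :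
    contr V₀ V₁ Y (contr V₀ V₁ X (poisson b I I)) =
      poisson b (contr V₀ V₁ Y (contr V₀ V₁ X I)) I +
        poisson b I (contr V₀ V₁ Y (contr V₀ V₁ X I)) +
        (poisson b (contr V₀ V₁ X I) (contr V₀ V₁ Y I) -
          sgn y x • poisson b (contr V₀ V₁ Y I) (contr V₀ V₁ X I)) := by
  have degree_I := bidegree_le_degree 3 0 hI
  have even_I : HasParity 0 I := fun x => parityTwist_of_mem x hI
  rw [contr_poisson_of_mem b hX degree_I even_I, map_add, map_smul, map_smul,
    contr_poisson_of_mem b hY (contr_mem X degree_I) even_I,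
    contr_poisson_of_mem b hY degree_I (even_I.contr hX), sgn_zero_right, sgn_zero_right, zero_add]
  module

theorem eval_four (A : SuperExt V₀ V₁) (X Y Z T : V₀ × V₁) :
    eval 4 ![X, Y, Z, T] A = scalarPart V₀ V₁
      (contr V₀ V₁ T (contr V₀ V₁ Z (contr V₀ V₁ Y (contr V₀ V₁ X A)))) :=
  (eval_succ ![X, Y, Z, T] A).trans (eval_three (contr V₀ V₁ X A) Y Z T)

theorem eval_four_poisson_self (hB : IsQuadraticSpace B) {I : SuperExt V₀ V₁}
    (hI : I ∈ bidegree V₀ V₁ 3 0) {F : V₀ × V₁ →ₗ[ℂ] V₀ × V₁ →ₗ[ℂ] V₀ × V₁}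
    (h : IsAssociated B F I) {x y z t : ZMod 2} {X Y Z T : V₀ × V₁} (hX : X ∈ part V₀ V₁ x)
    (hY : Y ∈ part V₀ V₁ y) (hZ : Z ∈ part V₀ V₁ z) (hT : T ∈ part V₀ V₁ t) :
    eval 4 ![X, Y, Z, T] (poisson b I I) = 2 * (B (F X Y) (F Z T) -
      sgn y z * B (F X Z) (F Y T) + sgn x (y + z) * B (F Y Z) (F X T)) := by
  have even_F := (h.isEvenSuperAntisymm hB hI).even
  have mem_two (W) : contr V₀ V₁ W I ∈ degree V₀ V₁ 2 := contr_mem W (bidegree_le_degree 3 0 hI)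
  have mem_one (W W') : contr V₀ V₁ W (contr V₀ V₁ W' I) ∈ degree V₀ V₁ 1 :=
    contr_mem W (mem_two W')
  have parity_one {w} {W : V₀ × V₁} (hW : W ∈ part V₀ V₁ w) : HasParity w (contr V₀ V₁ W I) := by
    simpa only [zero_add] using HasParity.contr (fun x => parityTwist_of_mem x hI) hW
  have poisson_contr (W W' U U') : poisson b (contr V₀ V₁ W' (contr V₀ V₁ W I))
      (contr V₀ V₁ U' (contr V₀ V₁ U I)) = B (F W W') (F U U') • 1 :=
    poisson_of_mem_one b hB (mem_one _ _) (mem_one _ _) (h W W') (h U U')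
  have scalarPart_one : scalarPart V₀ V₁ 1 = 1 :=
    (scalarPart_tmul 1 1).trans (by rw [map_one, map_one, one_mul])
  rw [eval_four, contr_contr_poisson_self b hX hY hI]
  simp only [map_add, map_sub, map_smul, map_neg, contr_poisson_of_mem_one_left b hZ (mem_one Y X),
    contr_poisson_of_mem_one_left b hT (mem_one Y X),
    contr_poisson_of_mem_one_right b hZ _ (mem_one Y X) ((parity_one hX).contr hY),
    contr_poisson_of_mem_one_right b hT _ (mem_one Y X) ((parity_one hX).contr hY),
    contr_contr_poisson_of_mem_two b hZ hT (mem_two _) (mem_two _) (parity_one hX),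
    contr_contr_poisson_of_mem_two b hZ hT (mem_two _) (mem_two _) (parity_one hY),
    poisson_contr, scalarPart_one, smul_eq_mul, mul_one, neg_neg]
  rw [hB.supersymm _ _ _ (even_F x t X hX T hT) _ (even_F y z Y hY Z hZ),
    hB.supersymm _ _ _ (even_F y t Y hY T hT) _ (even_F x z X hX Z hZ),
    hB.supersymm _ _ _ (even_F z t Z hZ T hT) _ (even_F x y X hX Y hY)]
  obtain rfl | rfl := zmod_two_cases x <;> obtain rfl | rfl := zmod_two_cases y <;>
    obtain rfl | rfl := zmod_two_cases z <;> obtain rfl | rfl := zmod_two_cases t <;>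
    simp only [sgn_zero_left, sgn_zero_right, sgn_one_one, CharTwo.add_self_eq_zero, add_zero,
      zero_add] <;> ring

theorem apply_jacobiator {F : V₀ × V₁ →ₗ[ℂ] V₀ × V₁ →ₗ[ℂ] V₀ × V₁} (hF : IsEvenSuperAntisymm F)
    (hinv : IsInvariant B F) {x y z : ZMod 2} {X Y Z : V₀ × V₁} (hX : X ∈ part V₀ V₁ x)
    (hY : Y ∈ part V₀ V₁ y) (hZ : Z ∈ part V₀ V₁ z) (T : V₀ × V₁) :
    B (F (F X Y) Z + sgn x y • F Y (F X Z) - F X (F Y Z)) T =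
      B (F X Y) (F Z T) - sgn y z * B (F X Z) (F Y T) + sgn x (y + z) * B (F Y Z) (F X T) := by
  rw [hF.antisymm _ _ X hX _ (hF.even y z Y hY Z hZ),
    hF.antisymm _ _ Y hY _ (hF.even x z X hX Z hZ)]
  simp only [map_add, map_sub, map_smul, LinearMap.add_apply, LinearMap.sub_apply,
    LinearMap.smul_apply, smul_eq_mul, hinv _ _ T, sgn_add_right y x z, sgn_comm y x]
  linear_combination -(sgn y z * B (F X Z) (F Y T)) * sgn_mul_self x y

theorem IsAssociated.isLieSuper_iff [FiniteDimensional ℂ V₀] [FiniteDimensional ℂ V₁]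
    (hB : IsQuadraticSpace B) {I : SuperExt V₀ V₁} (hI : I ∈ bidegree V₀ V₁ 3 0)
    {F : V₀ × V₁ →ₗ[ℂ] V₀ × V₁ →ₗ[ℂ] V₀ × V₁} (h : IsAssociated B F I) :
    IsLieSuper F ↔ poisson b I I = 0 := by
  have antisymm_F := h.isEvenSuperAntisymm hB hI
  have eval_eq_jacobiator {x y z t} {X Y Z T : V₀ × V₁} (hX : X ∈ part V₀ V₁ x)
      (hY : Y ∈ part V₀ V₁ y) (hZ : Z ∈ part V₀ V₁ z) (hT : T ∈ part V₀ V₁ t) :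
      eval 4 ![X, Y, Z, T] (poisson b I I) =
        2 * B (F (F X Y) Z + sgn x y • F Y (F X Z) - F X (F Y Z)) T := by
    rw [eval_four_poisson_self b hB hI h hX hY hZ hT,
      apply_jacobiator antisymm_F (h.isInvariant hB hI) hX hY hZ]
  have degree_I := bidegree_le_degree 3 0 hI
  constructor
  · intro lie_F
    refine eq_zero_of_eval_eq_zero (poisson_mem (n := 2) (m := 2) b degree_I degree_I)
      fun v homogeneous_v => ?_
    choose x hv using homogeneous_v
    rw [show v = ![v 0, v 1, v 2, v 3] from List.ofFn_injective rfl,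
      eval_eq_jacobiator (hv 0) (hv 1) (hv 2) (hv 3), ← lie_F.jacobi _ _ _ (hv 0) _ (hv 1),
      sub_self, map_zero, LinearMap.zero_apply, mul_zero]
  · intro poisson_I
    refine { antisymm_F with jacobi := fun x y X hX Y hY Z => ?_ }
    suffices F X ∘ₗ F Y = F (F X Y) + sgn x y • (F Y ∘ₗ F X) from congr($this Z)
    refine linearMap_ext_part fun z Z hZ => (sub_eq_zero.mp (hB.nondegenerate.1 _ ?_)).symm
    refine fun T => LinearMap.congr_fun (g := 0) (linearMap_ext_part fun t T hT => ?_) T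
    have eval_eq := eval_eq_jacobiator hX hY hZ hT
    rw [poisson_I, map_zero, eq_comm, mul_eq_zero_iff_left two_ne_zero] at eval_eq
    exact eval_eq

end Jacobi

section SuperAlternating

variable {V₀ V₁ : Type*} [AddCommGroup V₀] [Module ℂ V₀] [AddCommGroup V₁] [Module ℂ V₁]
variable {T T' : V₀ × V₁ →ₗ[ℂ] V₀ × V₁ →ₗ[ℂ] V₀ × V₁ →ₗ[ℂ] ℂ}

/-- Even super-antisymmetric trilinear forms on `g`, the forms represented by `E^{(3,0)}(g)`. -/
structure IsSuperAlternating (T : V₀ × V₁ →ₗ[ℂ] V₀ × V₁ →ₗ[ℂ] V₀ × V₁ →ₗ[ℂ] ℂ) : Prop where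
  swap_left : ∀ x y : ZMod 2, ∀ X ∈ part V₀ V₁ x, ∀ Y ∈ part V₀ V₁ y, ∀ Z,
    T X Y Z = -sgn x y * T Y X Z
  swap_right : ∀ y z : ZMod 2, ∀ X, ∀ Y ∈ part V₀ V₁ y, ∀ Z ∈ part V₀ V₁ z,
    T X Y Z = -sgn y z * T X Z Y
  even : ∀ x y z : ZMod 2, ∀ X ∈ part V₀ V₁ x, ∀ Y ∈ part V₀ V₁ y, ∀ Z ∈ part V₀ V₁ z,
    x + y + z = 1 → T X Y Z = 0

theorem isSuperAlternating_form {n : ℕ} {A : SuperExt V₀ V₁} (hA : A ∈ bidegree V₀ V₁ n 0) :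
    IsSuperAlternating (form V₀ V₁ A) where
  swap_left _ _ _ hX _ hY Z := form_swap_left A hX hY Z
  swap_right _ _ X _ hY _ hZ := form_swap_right A X hY hZ
  even _ _ _ _ hX _ hY _ hZ h := form_eq_zero hA hX hY hZ (by rw [h, zero_add])

theorem IsEvenSuperAntisymm.isSuperAlternating {B : LinearMap.BilinForm ℂ (V₀ × V₁)}
    (hB : IsQuadraticSpace B) {F : V₀ × V₁ →ₗ[ℂ] V₀ × V₁ →ₗ[ℂ] V₀ × V₁}
    (hF : IsEvenSuperAntisymm F) (hinv : IsInvariant B F) : IsSuperAlternating (F.compr₂ B) where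
  swap_left x y X hX Y hY Z := by
    rw [LinearMap.compr₂_apply, LinearMap.compr₂_apply, hF.antisymm x y X hX Y hY, map_smul,
      LinearMap.smul_apply, smul_eq_mul]
  swap_right y z X Y hY Z hZ := by
    rw [LinearMap.compr₂_apply, LinearMap.compr₂_apply, hinv, hinv, hF.antisymm y z Y hY Z hZ,
      map_smul, smul_eq_mul]
  even x y z X hX Y hY Z hZ h := by
    have hXY := hF.even x y X hX Y hY
    rw [LinearMap.compr₂_apply]
    obtain hxy | hxy := zmod_two_cases (x + y) <;> rw [hxy] at h hXY
    · obtain rfl : z = 1 := by rwa [zero_add] at h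
      exact hB.even _ hXY _ hZ
    · obtain rfl : z = 0 := by rwa [add_eq_left] at h
      rw [hB.supersymm 1 0 _ hXY _ hZ, hB.even _ hZ _ hXY, mul_zero]

theorem IsSuperAlternating.ext (hT : IsSuperAlternating T) (hT' : IsSuperAlternating T')
    (even : ∀ X Y Z : V₀, T (X, 0) (Y, 0) (Z, 0) = T' (X, 0) (Y, 0) (Z, 0))
    (mixed : ∀ (X : V₀) (Y Z : V₁), T (X, 0) (0, Y) (0, Z) = T' (X, 0) (0, Y) (0, Z)) :
    T = T' := by
  refine linearMap_ext_part fun x X hX => linearMap_ext_part fun y Y hY =>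
    linearMap_ext_part fun z Z hZ => ?_
  obtain h | h := zmod_two_cases (x + y + z)
  · obtain ⟨rfl, X, rfl⟩ | ⟨rfl, X, rfl⟩ := mem_part_cases hX <;>
    obtain ⟨rfl, Y, rfl⟩ | ⟨rfl, Y, rfl⟩ := mem_part_cases hY <;>
    obtain ⟨rfl, Z, rfl⟩ | ⟨rfl, Z, rfl⟩ := mem_part_cases hZ <;>
    first | exact absurd h (by decide) | skip
    · exact even X Y Z
    · exact mixed X Y Z
    · rw [hT.swap_left 1 0 _ hX _ hY, hT'.swap_left 1 0 _ hX _ hY, mixed]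
    · rw [hT.swap_right 1 0 _ _ hY _ hZ, hT'.swap_right 1 0 _ _ hY _ hZ,
        hT.swap_left 1 0 _ hX _ hZ, hT'.swap_left 1 0 _ hX _ hZ, mixed]
  · rw [hT.even x y z X hX Y hY Z hZ h, hT'.even x y z X hX Y hY Z hZ h]

end SuperAlternating

section CoordinateExpansion

theorem sum_trilinear_mul_coord {R M N P κ κ' κ'' : Type*} [CommRing R] [AddCommGroup M]
    [Module R M] [AddCommGroup N] [Module R N] [AddCommGroup P] [Module R P] [Fintype κ]
    [Fintype κ'] [Fintype κ''] (e : Module.Basis κ R M) (e' : Module.Basis κ' R N)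
    (e'' : Module.Basis κ'' R P) (S : M →ₗ[R] N →ₗ[R] P →ₗ[R] R) (X : M) (Y : N) (Z : P) :
    ∑ j, ∑ k, ∑ l, S (e j) (e' k) (e'' l) * (e.coord j X * e'.coord k Y * e''.coord l Z) =
      S X Y Z := by
  conv_rhs => rw [← e.sum_repr X, ← e'.sum_repr Y, ← e''.sum_repr Z]
  simp only [map_sum, map_smul, LinearMap.sum_apply, LinearMap.smul_apply, smul_eq_mul,
    Module.Basis.coord_apply, Finset.mul_sum]
  conv_rhs => rw [Finset.sum_comm_cycle]
  exact Finset.sum_congr rfl fun j _ => Finset.sum_comm.trans <|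
    Finset.sum_congr rfl fun l _ => Finset.sum_congr rfl fun k _ => by ring

variable {V₀ V₁ κ₀ κ₁ : Type*} [AddCommGroup V₀] [Module ℂ V₀] [AddCommGroup V₁] [Module ℂ V₁]
  [Fintype κ₀] [Fintype κ₁]

theorem form_cubic_even (α β γ : Module.Dual ℂ V₀) (X Y Z : V₀) :
    form V₀ V₁ (ofTensor V₀ V₁ ((ExteriorAlgebra.ι ℂ α * (ExteriorAlgebra.ι ℂ β *
      ExteriorAlgebra.ι ℂ γ)) ⊗ₜ[ℂ] 1)) (X, 0) (Y, 0) (Z, 0) =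
    α X * β Y * γ Z - α X * β Z * γ Y - α Y * β X * γ Z + α Z * β X * γ Y +
      α Y * β Z * γ X - α Z * β Y * γ X := by
  have altInterior_one : altInterior Z (1 : Alt V₀) = 0 := by
    simpa only [map_one] using altInterior_algebraMap Z 1
  rw [form_apply, contr_even_tmul, contr_even_tmul, contr_even_tmul, scalarPart_tmul]
  simp only [altInterior_ι_mul, altInterior_ι, altInterior_one, map_sub, map_smul,
    Algebra.algebraMap_eq_smul_one, mul_smul_comm, mul_one, map_one, smul_sub, smul_smul,
    smul_eq_mul, smul_zero, sub_zero, mul_zero]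
  ring

theorem form_tmul_one_mixed (Ω : Alt V₀) (X : V₀) (Y Z : V₁) :
    form V₀ V₁ (ofTensor V₀ V₁ (Ω ⊗ₜ[ℂ] 1)) (X, 0) (0, Y) (0, Z) = 0 := by
  rw [form_apply, contr_even_tmul, contr_odd_tmul, Derivation.map_one_eq_zero, map_zero,
    TensorProduct.tmul_zero, map_zero, map_zero, map_zero]

theorem form_ι_tmul_even (α : Module.Dual ℂ V₀) (F : Sym V₁) (X Y Z : V₀) :
    form V₀ V₁ (ofTensor V₀ V₁ (ExteriorAlgebra.ι ℂ α ⊗ₜ[ℂ] F)) (X, 0) (Y, 0) (Z, 0) = 0 := by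
  rw [form_apply, contr_even_tmul, contr_even_tmul, altInterior_ι, altInterior_algebraMap,
    TensorProduct.zero_tmul, map_zero, map_zero, map_zero]

theorem form_ι_tmul_quadratic_mixed (α : Module.Dual ℂ V₀) (p q : Module.Dual ℂ V₁) (X : V₀)
    (Y Z : V₁) :
    form V₀ V₁ (ofTensor V₀ V₁ (ExteriorAlgebra.ι ℂ α ⊗ₜ[ℂ]
      (SymmetricAlgebra.ι ℂ _ p * SymmetricAlgebra.ι ℂ _ q))) (X, 0) (0, Y) (0, Z) =
      -(α X * p Y * q Z + α X * p Z * q Y) := by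
  simp only [form_apply, contr_even_tmul, contr_odd_tmul, scalarPart_tmul, altInterior_ι,
    altSign_algebraMap, Derivation.leibniz, symDeriv_ι, smul_eq_mul, map_add, symSign_mul,
    symSign_ι, symSign_algebraMap, map_neg, Derivation.map_algebraMap, mul_zero, map_zero, map_mul,
    ExteriorAlgebra.algebraMap_leftInverse _ _, SymmetricAlgebra.algebraMap_leftInverse _ _]
  ring

variable (V₁) in
/-- The antisymmetrisation `∑ S(eⱼ, eₖ, eₗ) eⱼ* ∧ eₖ* ∧ eₗ*` of a trilinear form on `g₀`, for a
basis `e` of `g₀`. -/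
def cubicElement (e : Module.Basis κ₀ ℂ V₀) (S : V₀ →ₗ[ℂ] V₀ →ₗ[ℂ] V₀ →ₗ[ℂ] ℂ) :
    SuperExt V₀ V₁ :=
  ∑ j, ∑ k, ∑ l, S (e j) (e k) (e l) •
    ofTensor V₀ V₁ ((ExteriorAlgebra.ι ℂ (e.coord j) * (ExteriorAlgebra.ι ℂ (e.coord k) *
      ExteriorAlgebra.ι ℂ (e.coord l))) ⊗ₜ[ℂ] 1)

/-- The symmetrisation `∑ S(eⱼ, e'ₖ, e'ₗ) eⱼ* ⊗ e'ₖ* e'ₗ*` in the odd variables of a trilinear form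
on `g₀ × g₁ × g₁`, for bases `e` of `g₀` and `e'` of `g₁`. -/
def mixedElement (e : Module.Basis κ₀ ℂ V₀) (e' : Module.Basis κ₁ ℂ V₁)
    (S : V₀ →ₗ[ℂ] V₁ →ₗ[ℂ] V₁ →ₗ[ℂ] ℂ) : SuperExt V₀ V₁ :=
  ∑ j, ∑ k, ∑ l, S (e j) (e' k) (e' l) •
    ofTensor V₀ V₁ (ExteriorAlgebra.ι ℂ (e.coord j) ⊗ₜ[ℂ]
      (SymmetricAlgebra.ι ℂ _ (e'.coord k) * SymmetricAlgebra.ι ℂ _ (e'.coord l)))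

variable (e : Module.Basis κ₀ ℂ V₀) (e' : Module.Basis κ₁ ℂ V₁)

theorem cubicElement_mem (S : V₀ →ₗ[ℂ] V₀ →ₗ[ℂ] V₀ →ₗ[ℂ] ℂ) :
    cubicElement V₁ e S ∈ bidegree V₀ V₁ 3 0 := by
  refine sum_mem fun j _ => sum_mem fun k _ => sum_mem fun l _ => Submodule.smul_mem _ _ ?_
  refine tensorPart_le_bidegree (ω := 3) (f := 0) rfl rfl (tmul_mem_tensorPart ?_
    SetLike.GradedOne.one_mem)
  rw [← mul_one (ExteriorAlgebra.ι ℂ (e.coord l))]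
  exact ι_mul_mem_altPow _ (ι_mul_mem_altPow _ (ι_mul_mem_altPow _ SetLike.GradedOne.one_mem))

theorem mixedElement_mem (S : V₀ →ₗ[ℂ] V₁ →ₗ[ℂ] V₁ →ₗ[ℂ] ℂ) :
    mixedElement e e' S ∈ bidegree V₀ V₁ 3 0 := by
  refine sum_mem fun j _ => sum_mem fun k _ => sum_mem fun l _ => Submodule.smul_mem _ _ ?_
  rw [← mul_one (ExteriorAlgebra.ι ℂ (e.coord j)), ← mul_one (SymmetricAlgebra.ι ℂ _ (e'.coord l))]
  exact tensorPart_le_bidegree (ω := 1) (f := 2) rfl rfl (tmul_mem_tensorPart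
    (ι_mul_mem_altPow _ SetLike.GradedOne.one_mem)
    (ι_mul_mem_symPow _ (ι_mul_mem_symPow _ SetLike.GradedOne.one_mem)))

theorem form_cubicElement_even (S : V₀ →ₗ[ℂ] V₀ →ₗ[ℂ] V₀ →ₗ[ℂ] ℂ) (X Y Z : V₀) :
    form V₀ V₁ (cubicElement V₁ e S) (X, 0) (Y, 0) (Z, 0) =
      S X Y Z - S X Z Y - S Y X Z + S Z X Y + S Y Z X - S Z Y X := by
  have expand := sum_trilinear_mul_coord e e e S
  rw [← expand X Y Z, ← expand X Z Y, ← expand Y X Z, ← expand Z X Y, ← expand Y Z X,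
    ← expand Z Y X]
  simp only [cubicElement, ← Finset.sum_sub_distrib,
    ← Finset.sum_add_distrib, map_sum, map_smul, LinearMap.sum_apply, LinearMap.smul_apply,
    form_cubic_even, smul_eq_mul]
  exact Finset.sum_congr rfl fun j _ => Finset.sum_congr rfl fun k _ =>
    Finset.sum_congr rfl fun l _ => by ring

theorem form_cubicElement_mixed (S : V₀ →ₗ[ℂ] V₀ →ₗ[ℂ] V₀ →ₗ[ℂ] ℂ) (X : V₀) (Y Z : V₁) :
    form V₀ V₁ (cubicElement V₁ e S) (X, 0) (0, Y) (0, Z) = 0 := by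
  simp only [cubicElement, map_sum, map_smul, LinearMap.sum_apply, LinearMap.smul_apply,
    form_tmul_one_mixed, smul_zero, Finset.sum_const_zero]

theorem form_mixedElement_even (S : V₀ →ₗ[ℂ] V₁ →ₗ[ℂ] V₁ →ₗ[ℂ] ℂ) (X Y Z : V₀) :
    form V₀ V₁ (mixedElement e e' S) (X, 0) (Y, 0) (Z, 0) = 0 := by
  simp only [mixedElement, map_sum, map_smul, LinearMap.sum_apply, LinearMap.smul_apply,
    form_ι_tmul_even, smul_zero, Finset.sum_const_zero]

theorem form_mixedElement_mixed (S : V₀ →ₗ[ℂ] V₁ →ₗ[ℂ] V₁ →ₗ[ℂ] ℂ) (X : V₀) (Y Z : V₁) :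
    form V₀ V₁ (mixedElement e e' S) (X, 0) (0, Y) (0, Z) = -(S X Y Z + S X Z Y) := by
  rw [← sum_trilinear_mul_coord e e' e' S X Y Z, ← sum_trilinear_mul_coord e e' e' S X Z Y]
  simp only [mixedElement, ← Finset.sum_neg_distrib,
    ← Finset.sum_add_distrib, map_sum, map_smul, LinearMap.sum_apply, LinearMap.smul_apply,
    form_ι_tmul_quadratic_mixed, smul_eq_mul]
  exact Finset.sum_congr rfl fun j _ => Finset.sum_congr rfl fun k _ =>
    Finset.sum_congr rfl fun l _ => by ring

theorem IsSuperAlternating.exists_form_eq [FiniteDimensional ℂ V₀] [FiniteDimensional ℂ V₁]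
    {T : V₀ × V₁ →ₗ[ℂ] V₀ × V₁ →ₗ[ℂ] V₀ × V₁ →ₗ[ℂ] ℂ} (hT : IsSuperAlternating T) :
    ∃ I ∈ bidegree V₀ V₁ 3 0, form V₀ V₁ I = T := by
  let e := Module.finBasis ℂ V₀
  let i := LinearMap.inl ℂ V₀ V₁
  let i' := LinearMap.inr ℂ V₀ V₁
  let S : V₀ →ₗ[ℂ] V₀ →ₗ[ℂ] V₀ →ₗ[ℂ] ℂ := (T.compl₁₂ i i).compr₂ (LinearMap.lcomp ℂ ℂ i)
  let S' : V₀ →ₗ[ℂ] V₁ →ₗ[ℂ] V₁ →ₗ[ℂ] ℂ := (T.compl₁₂ i i').compr₂ (LinearMap.lcomp ℂ ℂ i')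
  let I := (6 : ℂ)⁻¹ • cubicElement V₁ e S - (2 : ℂ)⁻¹ • mixedElement e (Module.finBasis ℂ V₁) S'
  have hI : I ∈ bidegree V₀ V₁ 3 0 := sub_mem (Submodule.smul_mem _ _ (cubicElement_mem _ _))
    (Submodule.smul_mem _ _ (mixedElement_mem _ _ _))
  refine ⟨I, hI, (isSuperAlternating_form hI).ext hT (fun X Y Z => ?_) (fun X Y Z => ?_)⟩
  · have swap_left (X Y Z : V₀) : S X Y Z = -S Y X Z :=
      (hT.swap_left 0 0 _ (even_mem_part X) _ (even_mem_part Y) (i Z)).trans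
        (by rw [sgn_zero_left, neg_one_mul]; rfl)
    have swap_right (X Y Z : V₀) : S X Y Z = -S X Z Y :=
      (hT.swap_right 0 0 (i X) _ (even_mem_part Y) _ (even_mem_part Z)).trans
        (by rw [sgn_zero_left, neg_one_mul]; rfl)
    simp only [I, map_sub, map_smul, LinearMap.sub_apply, LinearMap.smul_apply, smul_eq_mul,
      form_cubicElement_even, form_mixedElement_even]
    change _ = S X Y Z
    linear_combination (6 : ℂ)⁻¹ * (-3 * swap_right X Y Z - 2 * swap_left X Y Z +
      2 * swap_left X Z Y + swap_right Y X Z - swap_right Z X Y)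
  · have swap_right : S' X Z Y = S' X Y Z :=
      (hT.swap_right 1 1 (i X) _ (odd_mem_part Z) _ (odd_mem_part Y)).trans
        (by rw [sgn_one_one, neg_neg, one_mul]; rfl)
    simp only [I, map_sub, map_smul, LinearMap.sub_apply, LinearMap.smul_apply, smul_eq_mul,
      form_cubicElement_mixed, form_mixedElement_mixed, swap_right]
    change _ = S' X Y Z
    ring

end CoordinateExpansion

section Bases

variable {K V : Type*} [Field K] [AddCommGroup V] [Module K V] {B : LinearMap.BilinForm K V}

theorem exists_orthonormal_basis [IsAlgClosed K] [Invertible (2 : K)] [FiniteDimensional K V]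
    (hsymm : LinearMap.IsSymm B) (hsep : B.SeparatingLeft) :
    ∃ e : Module.Basis (Fin (Module.finrank K V)) K V,
      ∀ i j, B (e i) (e j) = if i = j then 1 else 0 := by
  obtain ⟨v, orthogonal_v⟩ := LinearMap.BilinForm.exists_orthogonal_basis hsymm
  have norm_ne_zero (i) : B (v i) (v i) ≠ 0 := fun norm_eq_zero => by
    suffices B (v i) = 0 from v.ne_zero i (hsep _ (LinearMap.congr_fun this))
    refine v.ext fun j => ?_
    obtain rfl | ne := eq_or_ne i j
    exacts [norm_eq_zero, orthogonal_v ne]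
  choose c hc using fun i => IsAlgClosed.exists_pow_nat_eq (B (v i) (v i)) two_pos
  have c_ne_zero (i) : c i ≠ 0 := fun h => norm_ne_zero i (by rw [← hc, h, zero_pow two_ne_zero])
  refine ⟨v.isUnitSMul fun i => (inv_ne_zero (c_ne_zero i)).isUnit, fun i j => ?_⟩
  rw [Module.Basis.isUnitSMul_apply, Module.Basis.isUnitSMul_apply, map_smul, map_smul,
    LinearMap.smul_apply, smul_eq_mul, smul_eq_mul]
  split_ifs with h
  · subst h
    have := c_ne_zero i
    rw [← hc]
    field_simp
  · rw [show B (v i) (v j) = 0 from orthogonal_v h, mul_zero, mul_zero]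

/-- The families `p` and `q` satisfy the Darboux relations `B(pᵢ, pⱼ) = B(qᵢ, qⱼ) = 0` and
`B(pᵢ, qⱼ) = δᵢⱼ`. -/
structure IsDarboux (B : LinearMap.BilinForm K V) {n : ℕ} (p q : Fin n → V) : Prop where
  left : ∀ i j, B (p i) (p j) = 0
  right : ∀ i j, B (q i) (q j) = 0
  pairing : ∀ i j, B (p i) (q j) = if i = j then 1 else 0

namespace IsDarboux

variable {n : ℕ} {p q : Fin n → V}

theorem linearIndependent (h : IsDarboux B p q) : LinearIndependent K (Sum.elim p q) := by
  rw [Fintype.linearIndependent_iff]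
  intro g hg
  simp only [Fintype.sum_sum_type, Sum.elim_inl, Sum.elim_inr] at hg
  rintro (j | j)
  · simpa [LinearMap.sum_apply, h.pairing, h.right] using congr(B $hg (q j))
  · simpa [h.pairing, h.left] using congr(B (p j) $hg)

theorem exists_sub_orthogonal (halt : LinearMap.IsAlt B) (h : IsDarboux B p q) (x : V) :
    ∃ s ∈ Submodule.span K (Set.range (Sum.elim p q)),
      (∀ j, B (x - s) (p j) = 0) ∧ ∀ j, B (x - s) (q j) = 0 := by
  refine ⟨∑ i, (B x (q i) • p i - B x (p i) • q i), ?_, fun j => ?_, fun j => ?_⟩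
  · exact sum_mem fun i _ => sub_mem
      (Submodule.smul_mem _ _ (Submodule.subset_span ⟨.inl i, rfl⟩))
      (Submodule.smul_mem _ _ (Submodule.subset_span ⟨.inr i, rfl⟩))
  · simp [LinearMap.sum_apply, h.left, ← halt.neg (p j), h.pairing]
  · simp [LinearMap.sum_apply, h.right, h.pairing]

theorem cons (halt : LinearMap.IsAlt B) (h : IsDarboux B p q) {u w : V} (huw : B u w = 1)
    (hup : ∀ j, B u (p j) = 0) (huq : ∀ j, B u (q j) = 0) (hwp : ∀ j, B w (p j) = 0)
    (hwq : ∀ j, B w (q j) = 0) :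
    IsDarboux B (Fin.cons u p : Fin (n + 1) → V) (Fin.cons w q) where
  left := Fin.cases (Fin.cases (halt u) hup) fun i =>
    Fin.cases (by simpa [hup] using (halt.neg u (p i)).symm) (h.left i)
  right := Fin.cases (Fin.cases (halt w) hwq) fun i =>
    Fin.cases (by simpa [hwq] using (halt.neg w (q i)).symm) (h.right i)
  pairing := Fin.cases
    (Fin.cases (by simpa using huw) fun j => by simpa [(Fin.succ_ne_zero j).symm] using huq j)
    fun i => Fin.cases (by simpa [Fin.succ_ne_zero, hwp] using (halt.neg w (p i)).symm)
      fun j => by simpa using h.pairing i j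

theorem exists_succ (halt : LinearMap.IsAlt B) (hsep : B.SeparatingLeft) (h : IsDarboux B p q)
    (hspan : ¬ ⊤ ≤ Submodule.span K (Set.range (Sum.elim p q))) :
    ∃ p' q' : Fin (n + 1) → V, IsDarboux B p' q' := by
  obtain ⟨x, -, hx⟩ := SetLike.not_le_iff_exists.mp hspan
  obtain ⟨s, hs, hup, huq⟩ := h.exists_sub_orthogonal halt x
  obtain ⟨y, hy⟩ : ∃ y, B (x - s) y ≠ 0 := by
    by_contra! orthogonal
    exact hx (sub_eq_zero.mp (hsep _ orthogonal) ▸ hs)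
  obtain ⟨r, hr, hwp, hwq⟩ := h.exists_sub_orthogonal halt ((B (x - s) y)⁻¹ • y)
  have span_le_ker : Submodule.span K (Set.range (Sum.elim p q)) ≤ (B (x - s)).ker := by
    rw [Submodule.span_le]
    rintro _ ⟨i | i, rfl⟩
    exacts [hup i, huq i]
  refine ⟨_, _, h.cons halt (w := (B (x - s) y)⁻¹ • y - r) ?_ hup huq hwp hwq⟩
  rw [map_sub, LinearMap.mem_ker.mp (span_le_ker hr), map_smul, smul_eq_mul, inv_mul_cancel₀ hy,
    sub_zero]

end IsDarboux

theorem exists_darboux_basis [FiniteDimensional K V] (halt : LinearMap.IsAlt B)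
    (hsep : B.SeparatingLeft) :
    ∃ (n : ℕ) (e : Module.Basis (Fin n ⊕ Fin n) K V), IsDarboux B (e ∘ .inl) (e ∘ .inr) := by
  by_contra not_exists
  have exists_family (n : ℕ) : ∃ p q : Fin n → V, IsDarboux B p q := by
    induction n with
    | zero => exact ⟨Fin.elim0, Fin.elim0, fun i => i.elim0, fun i => i.elim0, fun i => i.elim0⟩
    | succ n ih =>
      obtain ⟨p, q, h⟩ := ih
      refine h.exists_succ halt hsep fun hspan =>
        not_exists ⟨n, Module.Basis.mk h.linearIndependent hspan, ?_⟩
      rw [Module.Basis.coe_mk]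
      exact h
  obtain ⟨p, q, h⟩ := exists_family (Module.finrank K V + 1)
  have card_le := h.linearIndependent.fintype_card_le_finrank
  rw [Fintype.card_sum, Fintype.card_fin] at card_le
  lia

end Bases

section AdaptedBasis

variable {V₀ V₁ : Type*} [AddCommGroup V₀] [Module ℂ V₀] [AddCommGroup V₁] [Module ℂ V₁]
variable {B : LinearMap.BilinForm ℂ (V₀ × V₁)}

theorem IsQuadraticSpace.separatingLeft_even (hB : IsQuadraticSpace B) :
    (B.compl₁₂ (LinearMap.inl ℂ V₀ V₁) (LinearMap.inl ℂ V₀ V₁)).SeparatingLeft := fun X hX => by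
  refine congrArg Prod.fst (hB.nondegenerate.1 (X, 0) fun W => ?_)
  rw [← Prod.fst_add_snd W, map_add, hB.even_odd, add_zero]
  exact hX W.1

theorem IsQuadraticSpace.separatingLeft_odd (hB : IsQuadraticSpace B) :
    (B.compl₁₂ (LinearMap.inr ℂ V₀ V₁) (LinearMap.inr ℂ V₀ V₁)).SeparatingLeft := fun Y hY => by
  refine congrArg Prod.snd (hB.nondegenerate.1 (0, Y) fun W => ?_)
  rw [← Prod.fst_add_snd W, map_add, hB.odd_even, zero_add]
  exact hY W.2

theorem IsQuadraticSpace.nonempty_adaptedBasis [FiniteDimensional ℂ V₀] [FiniteDimensional ℂ V₁]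
    (hB : IsQuadraticSpace B) : Nonempty (AdaptedBasis B) := by
  obtain ⟨e, he⟩ := exists_orthonormal_basis ⟨hB.even_symm⟩ hB.separatingLeft_even
  obtain ⟨n, e', he'⟩ := exists_darboux_basis
    (fun Y => self_eq_neg.mp (hB.odd_antisymm Y Y)) hB.separatingLeft_odd
  exact ⟨⟨_, n, e, e', he, he'.left, he'.right, he'.pairing⟩⟩

end AdaptedBasis

section Correspondence

variable {V₀ V₁ : Type*} [AddCommGroup V₀] [Module ℂ V₀] [AddCommGroup V₁] [Module ℂ V₁]
variable [FiniteDimensional ℂ V₀] [FiniteDimensional ℂ V₁] {B : LinearMap.BilinForm ℂ (V₀ × V₁)}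
  {F : V₀ × V₁ →ₗ[ℂ] V₀ × V₁ →ₗ[ℂ] V₀ × V₁}

theorem IsAssociated.form_unique {I J : SuperExt V₀ V₁} (hI : I ∈ degree V₀ V₁ 3)
    (hJ : J ∈ degree V₀ V₁ 3) (h : IsAssociated B F I) (h' : IsAssociated B F J) : I = J := by
  refine sub_eq_zero.mp (eq_zero_of_eval_eq_zero (sub_mem hI hJ) fun v _ => ?_)
  rw [show v = ![v 0, v 1, v 2] from List.ofFn_injective rfl, map_sub, h, h', sub_self]

theorem IsQuadraticLieSuper.exists_isAssociated (hB : IsQuadraticSpace B)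
    (hF : IsQuadraticLieSuper B F) : ∃ I ∈ bidegree V₀ V₁ 3 0, IsAssociated B F I := by
  obtain ⟨I, hI, form_I⟩ :=
    (hF.1.toIsEvenSuperAntisymm.isSuperAlternating hB hF.2).exists_form_eq
  exact ⟨I, hI, fun X Y Z => by rw [eval_three, form_I, LinearMap.compr₂_apply]⟩

theorem isQuadraticLieSuper_bracketOf (hB : IsQuadraticSpace B) (b : AdaptedBasis B)
    {I : SuperExt V₀ V₁} (hI : I ∈ bidegree V₀ V₁ 3 0) (poisson_I : poisson b I I = 0) :
    IsQuadraticLieSuper B (bracketOf b I) :=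
  have assoc := isAssociated_bracketOf hB b hI
  ⟨(assoc.isLieSuper_iff b hB hI).mpr poisson_I, assoc.isInvariant hB hI⟩

/-- The bijection `I ↦ F`, `B(F(X, Y), Z) = I(X, Y, Z)`, from the `I ∈ E^{(3,0)}(g)` with
`{I, I} = 0` onto the quadratic Lie superalgebra structures on `(g, B)`. -/
def bracketEquiv (hB : IsQuadraticSpace B) (b : AdaptedBasis B) :
    {I : SuperExt V₀ V₁ // I ∈ bidegree V₀ V₁ 3 0 ∧ poisson b I I = 0} ≃
      {F : V₀ × V₁ →ₗ[ℂ] V₀ × V₁ →ₗ[ℂ] V₀ × V₁ // IsQuadraticLieSuper B F} :=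
  Equiv.ofBijective
    (fun I => ⟨bracketOf b I, isQuadraticLieSuper_bracketOf hB b I.2.1 I.2.2⟩) <| by
    refine ⟨fun I J h => Subtype.ext ?_, fun ⟨F, hF⟩ => ?_⟩
    · have bracket_eq : bracketOf b I.1 = bracketOf b J.1 := congrArg Subtype.val h
      exact (isAssociated_bracketOf hB b I.2.1).form_unique (bidegree_le_degree 3 0 I.2.1)
        (bidegree_le_degree 3 0 J.2.1) (bracket_eq ▸ isAssociated_bracketOf hB b J.2.1)
    · obtain ⟨I, hI, assoc⟩ := hF.exists_isAssociated hB
      exact ⟨⟨I, hI, (assoc.isLieSuper_iff b hB hI).mp hF.1⟩,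
        Subtype.ext ((isAssociated_bracketOf hB b hI).bracket_unique hB assoc)⟩

end Correspondence

end QuadSuper

end

open QuadSuper in
theorem mainTheorem9 {V₀ V₁ : Type*} [AddCommGroup V₀] [Module ℂ V₀] [FiniteDimensional ℂ V₀]
    [AddCommGroup V₁] [Module ℂ V₁] [FiniteDimensional ℂ V₁]
    (B : LinearMap.BilinForm ℂ (V₀ × V₁)) (hB : IsQuadraticSpace B) :
    Nonempty (AdaptedBasis B) ∧
    ∀ b : AdaptedBasis B,
      (bidegree V₀ V₁ 3 0 = tensorPart V₀ V₁ 3 0 ⊔ tensorPart V₀ V₁ 1 2 ∧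
        Disjoint (tensorPart V₀ V₁ 3 0) (tensorPart V₀ V₁ 1 2)) ∧
      (∀ F : V₀ × V₁ →ₗ[ℂ] V₀ × V₁ →ₗ[ℂ] V₀ × V₁, IsQuadraticLieSuper B F →
        ∃ I ∈ bidegree V₀ V₁ 3 0,
          IsAssociated B F I ∧
          (∀ J ∈ degree V₀ V₁ 3, IsAssociated B F J → J = I) ∧
          (∀ d, IsDifferential F d ↔ d = -poisson b I) ∧
          poisson b I I = 0) ∧
      (∀ I ∈ bidegree V₀ V₁ 3 0,
        ∃ F : V₀ × V₁ →ₗ[ℂ] V₀ × V₁ →ₗ[ℂ] V₀ × V₁,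
          IsEvenSuperAntisymm F ∧
          (∀ G, IsDifferential G (-poisson b I) ↔ G = F) ∧
          (IsLieSuper F ↔ poisson b I I = 0) ∧
          (poisson b I I = 0 → IsAssociated B F I ∧ IsInvariant B F)) ∧
      ∃ Φ : {F : V₀ × V₁ →ₗ[ℂ] V₀ × V₁ →ₗ[ℂ] V₀ × V₁ // IsQuadraticLieSuper B F} ≃
          {I : SuperExt V₀ V₁ // I ∈ bidegree V₀ V₁ 3 0 ∧ poisson b I I = 0},
        ∀ F, IsAssociated B F.1 (Φ F).1 ∧ IsDifferential F.1 (-poisson b (Φ F).1) := by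
  refine ⟨hB.nonempty_adaptedBasis, fun b =>
    ⟨⟨bidegree_three_zero, disjoint_tensorPart (by norm_num) 0 2⟩, fun F hF => ?_, fun I hI => ?_,
      (bracketEquiv hB b).symm, fun F => ?_⟩⟩
  · obtain ⟨I, hI, assoc⟩ := hF.exists_isAssociated hB
    have isDifferential_I := assoc.isDifferential hB b hI
    refine ⟨I, hI, assoc, fun J hJ assoc_J => ?_, fun d => ?_, ?_⟩
    · exact assoc_J.form_unique hJ (bidegree_le_degree 3 0 hI) assoc
    · exact ⟨fun h => h.unique_operator isDifferential_I, fun h => h ▸ isDifferential_I⟩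
    · exact (assoc.isLieSuper_iff b hB hI).mp hF.1
  · have assoc := isAssociated_bracketOf hB b hI
    have isDifferential_I := isDifferential_bracketOf b hI
    exact ⟨bracketOf b I, assoc.isEvenSuperAntisymm hB hI,
      fun G => ⟨fun h => h.unique_bracket isDifferential_I, fun h => h ▸ isDifferential_I⟩,
      assoc.isLieSuper_iff b hB hI, fun _ => ⟨assoc, assoc.isInvariant hB hI⟩⟩
  · obtain ⟨⟨I, hI, poisson_I⟩, rfl⟩ := (bracketEquiv hB b).surjective F
    rw [Equiv.symm_apply_apply]
    exact ⟨isAssociated_bracketOf hB b hI, isDifferential_bracketOf b hI⟩
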